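/- Work in $\mathbb{R}^3$ with Cartesian coordinates and summation over repeated indices. A homogeneous linear strain-gradient elastic material is a triple of constant tensors $(\mathsf C,\mathsf M,\mathsf A)$ of orders 4, 5, 6 with $\mathsf C_{ijlm}=\mathsf C_{jilm}=\mathsf C_{lmij}$, $\mathsf M_{ijklm}=\mathsf M_{jiklm}=\mathsf M_{ijlkm}$, $\mathsf A_{ijklmn}=\mathsf A_{jiklmn}=\mathsf A_{lmnijk}$. It belongs to the class $O(3)$ if all three tensors are invariant under every orthogonal matrix $Q\in O(3)$, i.e. $G_{\mathsf A}\cap G_{\mathsf M}\cap G_{\mathsf C}=O(3)$ for their symmetry groups. For a displacement field $u$ let $e_{lm}=\frac12(u_{l,m}+u_{m,l})$, $\sigma_{ik}=\mathsf C_{iklm}e_{lm}+\mathsf M_{iklmn}e_{lm,n}$ and $\tau_{ijk}=\mathsf M_{lmijk}e_{lm}+\mathsf A_{ijklmn}e_{lm,n}$. A field $u$ on an open set $\Omega\subseteq\mathbb{R}^3$ is a universal displacement of the class $O(3)$ if $\sigma_{ik,i}-\tau_{ikj,ij}=0$ in $\Omega$ for $k=1,2,3$ and for every material of the class. (a) A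 material belongs to the class $O(3)$ if and only if $\mathsf M=0$ and $\mathsf C$ and $\mathsf A$ are invariant under all of $O(3)$. Let $\Omega\subseteq\mathbb{R}^3$ be open and $u\in C^n(\Omega;\mathbb{R}^3)$ with $4\le n\le\infty$. For an open set $V$, a matrix $F\in\mathbb{R}^{3\times3}$ and a regularity $m$, say that $u$ has an $(m,F)$-potential in $V$ if, in $V$, $u_i=F_{ij}x_j+k_i+\Phi_{ij,j}$, where $k\in\mathbb{R}^3$ is constant and $\Phi$ is an antisymmetric matrix field of class $C^m$ whose components solve Poisson's equations $\Delta\Phi_{ij}=S_{ij}$ with antisymmetric sources satisfying $S_{ij,j}=0$. (b) $u$ is universal in $\Omega$ if and only if $\Delta u=0$ and $\operatorname{grad}\operatorname{div}u=0$ in $\Omega$. (c) If $\Omega$ is star-shaped (with respect to some point), then $u$ is universal if and only if it has an $(n,\frac c3 I)$-potential in $\Omega$ for some $c\in\mathbb{R}$. For arbitrary open $\Omega$, $u$ is universal if and only if for every star-shaped open $V\subseteq\Omega$ there is $c\in\mathbb{R}$ such that $u$ has an $(n,\frac c3 I)$-potential in $V$. (d) Conversely, for arbitrary open $\Omega$ and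 any matrix $F$, if $u$ has a $(3,F)$-potential in $\Omega$, then $u$ is universal. (e) If $u$ is universal in $\Omega$, then the higher-order terms vanish identically: $\Delta\Delta u=0$ and $\Delta(\operatorname{grad}\operatorname{div}u)=0$ in $\Omega$, and for every material of the class $O(3)$ and every $k$, $\tau_{ikj,ij}=0$ and $\tau_{ijk,ij}=0$ in $\Omega$. -/

import Mathlib

noncomputable section

namespace StrainGradient

/-- Physical space, with Cartesian coordinates `x 0, x 1, x 2`. -/
abbrev Space : Type := EuclideanSpace ℝ (Fin 3)

/-- The partial derivative of a scalar field with respect to the `i`-th Cartesian coordinate. -/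
def pd (i : Fin 3) (f : Space → ℝ) : Space → ℝ :=
  fun x => fderiv ℝ f x (EuclideanSpace.single i (1 : ℝ))

/-- The divergence of a vector field, `u_{i,i}`. -/
def divergence (u : Space → Space) : Space → ℝ :=
  fun x => ∑ i, pd i (fun y => u y i) x

/-- The linear strain `e_{lm} = (u_{l,m} + u_{m,l}) / 2`. -/
def strain (u : Space → Space) (l m : Fin 3) : Space → ℝ :=
  fun x => (1 / 2 : ℝ) * (pd m (fun y => u y l) x + pd l (fun y => u y m) x)

/-- Cartesian components of tensors of order four, five and six. -/
abbrev Tensor4 : Type := Fin 3 → Fin 3 → Fin 3 → Fin 3 → ℝ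

abbrev Tensor5 : Type := Fin 3 → Fin 3 → Fin 3 → Fin 3 → Fin 3 → ℝ

abbrev Tensor6 : Type := Fin 3 → Fin 3 → Fin 3 → Fin 3 → Fin 3 → Fin 3 → ℝ

/-- The transformed tensor `Q_{io} Q_{jp} Q_{kq} Q_{lr} C_{opqr}`. -/
def rotate4 (Q : Matrix (Fin 3) (Fin 3) ℝ) (C : Tensor4) : Tensor4 :=
  fun i j k l => ∑ o, ∑ p, ∑ q, ∑ r, Q i o * Q j p * Q k q * Q l r * C o p q r

/-- The transformed tensor `Q_{io} Q_{jp} Q_{kq} Q_{lr} Q_{ms} M_{opqrs}`. -/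
def rotate5 (Q : Matrix (Fin 3) (Fin 3) ℝ) (M : Tensor5) : Tensor5 :=
  fun i j k l m => ∑ o, ∑ p, ∑ q, ∑ r, ∑ s,
    Q i o * Q j p * Q k q * Q l r * Q m s * M o p q r s

/-- The transformed tensor `Q_{io} Q_{jp} Q_{kq} Q_{lr} Q_{ms} Q_{nt} A_{opqrst}`. -/
def rotate6 (Q : Matrix (Fin 3) (Fin 3) ℝ) (A : Tensor6) : Tensor6 :=
  fun i j k l m n => ∑ o, ∑ p, ∑ q, ∑ r, ∑ s, ∑ t,
    Q i o * Q j p * Q k q * Q l r * Q m s * Q n t * A o p q r s t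

/-- The symmetry groups of the three elasticity tensors, as subsets of the full orthogonal
group `O(3)`. -/
def symmetryGroup4 (C : Tensor4) : Set (Matrix.orthogonalGroup (Fin 3) ℝ) :=
  {Q | rotate4 Q.1 C = C}

def symmetryGroup5 (M : Tensor5) : Set (Matrix.orthogonalGroup (Fin 3) ℝ) :=
  {Q | rotate5 Q.1 M = M}

def symmetryGroup6 (A : Tensor6) : Set (Matrix.orthogonalGroup (Fin 3) ℝ) :=
  {Q | rotate6 Q.1 A = A}

/-- A homogeneous linear strain-gradient elastic material with stored energy
`W = (1/2) C_{ijlm} e_{ij} e_{lm} + M_{ijklm} e_{ij} e_{kl,m} + (1/2) A_{ijklmn} e_{ij,k} e_{lm,n}`: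
three constant elasticity tensors with their index symmetries. -/
structure Material where
  C : Tensor4
  M : Tensor5
  A : Tensor6
  C_minor : ∀ i j l m, C i j l m = C j i l m
  C_major : ∀ i j l m, C i j l m = C l m i j
  M_left : ∀ i j k l m, M i j k l m = M j i k l m
  M_right : ∀ i j k l m, M i j k l m = M i j l k m
  A_minor : ∀ i j k l m n, A i j k l m n = A j i k l m n
  A_major : ∀ i j k l m n, A i j k l m n = A l m n i j k

/-- The symmetry group of the material, `G_A ∩ G_M ∩ G_C`. -/
def Material.symmetryGroup (L : Material) : Set (Matrix.orthogonalGroup (Fin 3) ℝ) :=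
  symmetryGroup6 L.A ∩ symmetryGroup5 L.M ∩ symmetryGroup4 L.C

/-- The material belongs to the strain-gradient symmetry class `O(3)`. -/
def Material.IsClassO3 (L : Material) : Prop :=
  L.symmetryGroup = Set.univ

/-- The Cauchy stress `σ_{ik} = C_{iklm} e_{lm} + M_{iklmn} e_{lm,n}`. -/
def Material.stress (L : Material) (u : Space → Space) (i k : Fin 3) : Space → ℝ :=
  fun x => (∑ l, ∑ m, L.C i k l m * strain u l m x) +
    ∑ l, ∑ m, ∑ n, L.M i k l m n * pd n (strain u l m) x

/-- The hyper-stress `τ_{ijk} = M_{lmijk} e_{lm} + A_{ijklmn} e_{lm,n}`. It is conjugate to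
`e_{ij,k}`: symmetric in `i, j`, with the gradient direction in the last slot. -/
def Material.hyperstress (L : Material) (u : Space → Space) (i j k : Fin 3) : Space → ℝ :=
  fun x => (∑ l, ∑ m, L.M l m i j k * strain u l m x) +
    ∑ l, ∑ m, ∑ n, L.A i j k l m n * pd n (strain u l m) x

/-- Equilibrium in `Ω` without inertia and body forces: the divergence of `σ` minus the double
divergence of `τ` vanishes, where one of the two divergences of `τ` is taken in the gradient slot
(these are the Euler-Lagrange equations of the stored energy). -/
def Material.IsEquilibrium (L : Material) (Ω : Set Space) (u : Space → Space) : Prop :=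
  ∀ x ∈ Ω, ∀ k,
    (∑ i, pd i (L.stress u i k) x) - ∑ i, ∑ j, pd i (pd j (L.hyperstress u i k j)) x = 0

/-- `u` is a universal displacement in `Ω` for the class `O(3)`: it satisfies the equilibrium
equations without body forces for every material of the class. -/
def IsUniversalO3 (Ω : Set Space) (u : Space → Space) : Prop :=
  ∀ L : Material, L.IsClassO3 → L.IsEquilibrium Ω u

/-- In `V`, the field `u` is the sum of the homogeneous field `x ↦ F x + k` and the divergence
`Φ_{ij,j}` of an antisymmetric matrix field `Φ` of class `C^m`, whose components solve the Poisson
equations `Δ Φ_{ij} = S_{ij}`, where `S` is an antisymmetric matrix of sources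
with `S_{ij,j} = 0`. -/
def HasPotential (m : ℕ∞) (V : Set Space) (F : Matrix (Fin 3) (Fin 3) ℝ)
    (u : Space → Space) : Prop :=
  ∃ (k : Space) (Φ S : Fin 3 → Fin 3 → Space → ℝ),
    (∀ i j, ContDiffOn ℝ m (Φ i j) V) ∧
    (∀ i j, ∀ x ∈ V, Φ i j x = -Φ j i x) ∧
    (∀ i j, ∀ x ∈ V, S i j x = -S j i x) ∧
    (∀ i j, ∀ x ∈ V, Laplacian.laplacian (Φ i j) x = S i j x) ∧
    (∀ i, ∀ x ∈ V, ∑ j, pd j (S i j) x = 0) ∧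
    ∀ x ∈ V, ∀ i, u x i = (∑ j, F i j * x j) + k i + ∑ j, pd j (Φ i j) x

end StrainGradient

end

/-! Invariance under -1 kills the odd-order tensor `M`, so only `C` and `A` enter equilibrium,
through operators of order two and four on the displacement. The rotational invariance of `C` and
`A` makes the matrix symbols of these operators isotropic polynomials in ξ. Rotating ξ to the first
axis leaves only two scalars free, so the symbols are a|ξ|² I + b ξ ⊗ ξ and |ξ|² times such a matrix
(`isotropic_bilin_eq`). No classification of isotropic tensors of order six is needed. Since partial
derivatives commute, only the symbol of an operator matters (`sum_mul_eq_zero_of_symmetric`): the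
two operators act as aΔu + b grad div u and as Δ of such an expression. Hence Δu = 0 and grad div u
= 0 annihilate every term of every material. Conversely, two classical isotropic materials already
force these two conditions (`IsUniversalO3.isClassicalUniversal`).

On a star-shaped set, grad div u = 0 makes div u a constant c, and u - (c/3)x is divergence-free.
The Poincaré lemma (`exists_antisymmetric_potential`) writes it as Φ_{ij,j} by a radial homotopy
integral that keeps the class C^n. Then S = ΔΦ satisfies S_{ij,j} = Δ(Φ_{ij,j}) = Δu_i = 0. In the
other direction, antisymmetry of Φ gives div u = tr F, and S_{ij,j} = 0 gives Δu = 0. The two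
differential conditions are local, so balls suffice on an arbitrary open set. -/

namespace StrainGradient

/-! ### Partial derivatives and their symmetry. -/

section Calculus

variable {Ω : Set Space} {f g : Space → ℝ} {x : Space}

theorem pd_congr (hΩ : IsOpen Ω) (h : ∀ y ∈ Ω, f y = g y) (hx : x ∈ Ω) (i : Fin 3) :
    pd i f x = pd i g x := by
  have : f =ᶠ[nhds x] g := Filter.eventually_of_mem (hΩ.mem_nhds hx) h
  simp only [pd, this.fderiv_eq]

theorem pd_eq_zero (hΩ : IsOpen Ω) {c : ℝ} (h : ∀ y ∈ Ω, f y = c) (hx : x ∈ Ω) (i : Fin 3) :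
    pd i f x = 0 := by
  rw [pd_congr (g := fun _ => c) hΩ h hx]
  simp [pd]

theorem contDiffOn_pd (hΩ : IsOpen Ω) {m n : WithTop ℕ∞} (hf : ContDiffOn ℝ n f Ω)
    (h : m + 1 ≤ n) (i : Fin 3) : ContDiffOn ℝ m (pd i f) Ω :=
  (hf.fderiv_of_isOpen hΩ h).clm_apply contDiffOn_const

theorem differentiableAt_of_contDiffOn (hΩ : IsOpen Ω) {n : WithTop ℕ∞}
    (hf : ContDiffOn ℝ n f Ω) (hn : 1 ≤ n) (hx : x ∈ Ω) : DifferentiableAt ℝ f x :=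
  (hf.contDiffAt (hΩ.mem_nhds hx)).differentiableAt (by
    intro h; simp [h] at hn)

theorem pd_add (hf : DifferentiableAt ℝ f x) (hg : DifferentiableAt ℝ g x) (i : Fin 3) :
    pd i (fun y => f y + g y) x = pd i f x + pd i g x := by
  simp only [pd, fderiv_fun_add hf hg, add_apply]

theorem pd_sub (hf : DifferentiableAt ℝ f x) (hg : DifferentiableAt ℝ g x) (i : Fin 3) :
    pd i (fun y => f y - g y) x = pd i f x - pd i g x := by
  simp only [pd, fderiv_fun_sub hf hg, sub_apply]

theorem pd_neg (i : Fin 3) : pd i (fun y => -f y) x = -pd i f x := by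
  simp only [pd, fderiv_fun_neg, neg_apply]

theorem pd_const_mul (hf : DifferentiableAt ℝ f x) (c : ℝ) (i : Fin 3) :
    pd i (fun y => c * f y) x = c * pd i f x := by
  simp only [pd, fderiv_const_mul hf, smul_apply, smul_eq_mul]

theorem pd_mul (hf : DifferentiableAt ℝ f x) (hg : DifferentiableAt ℝ g x) (i : Fin 3) :
    pd i (fun y => f y * g y) x = f x * pd i g x + g x * pd i f x := by
  simp only [pd, fderiv_fun_mul hf hg, add_apply, smul_apply, smul_eq_mul]

theorem pd_sum {ι : Type*} {s : Finset ι} {F : ι → Space → ℝ}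
    (hF : ∀ a ∈ s, DifferentiableAt ℝ (F a) x) (i : Fin 3) :
    pd i (fun y => ∑ a ∈ s, F a y) x = ∑ a ∈ s, pd i (F a) x := by
  simp only [pd, fderiv_fun_sum hF, sum_apply]

theorem pd_coord (i j : Fin 3) : pd i (fun y => y j) x = if i = j then 1 else 0 := by
  have : (fun y : Space => y j) = ⇑(EuclideanSpace.proj j : Space →L[ℝ] ℝ) := rfl
  rw [pd, this, ContinuousLinearMap.fderiv]
  by_cases h : i = j
  · simp [h]
  · simp [h, Ne.symm h]

theorem fderiv_apply_eq_sum_pd (f : Space → ℝ) (x v : Space) :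
    fderiv ℝ f x v = ∑ i, v i * pd i f x := by
  conv_lhs => rw [← (EuclideanSpace.basisFun (Fin 3) ℝ).sum_repr v]
  simp [pd]

theorem fderiv_eq_zero_iff_pd : fderiv ℝ f x = 0 ↔ ∀ i, pd i f x = 0 := by
  constructor
  · intro h i
    simp [pd, h]
  · intro h
    ext v
    simp [fderiv_apply_eq_sum_pd, h]

theorem gradient_eq_zero_iff_pd : gradient f x = 0 ↔ ∀ i, pd i f x = 0 := by
  rw [← fderiv_eq_zero_iff_pd, gradient]
  simp

theorem pd_pd_eq_iteratedFDeriv (hf : ContDiffAt ℝ 2 f x) (i j : Fin 3) :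
    pd i (pd j f) x = iteratedFDeriv ℝ 2 f x
      ![EuclideanSpace.single i 1, EuclideanSpace.single j 1] := by
  have hd : DifferentiableAt ℝ (fderiv ℝ f) x :=
    (hf.fderiv_right (m := 1) (by norm_num)).differentiableAt (by norm_num)
  rw [iteratedFDeriv_two_apply]
  unfold pd
  rw [fderiv_clm_apply hd (differentiableAt_const _)]
  simp

theorem pd_comm (hf : ContDiffAt ℝ 2 f x) (i j : Fin 3) :
    pd i (pd j f) x = pd j (pd i f) x := by
  have hs : IsSymmSndFDerivAt ℝ f x := hf.isSymmSndFDerivAt (by simp)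
  rw [pd_pd_eq_iteratedFDeriv hf, pd_pd_eq_iteratedFDeriv hf, iteratedFDeriv_two_apply,
    iteratedFDeriv_two_apply]
  exact hs.eq _ _

theorem laplacian_eq_sum_pd (hf : ContDiffAt ℝ 2 f x) :
    Laplacian.laplacian f x = ∑ i, pd i (pd i f) x := by
  rw [InnerProductSpace.laplacian_eq_iteratedFDeriv_orthonormalBasis f
    (EuclideanSpace.basisFun (Fin 3) ℝ)]
  simp [pd_pd_eq_iteratedFDeriv hf]

theorem laplacian_apply {u : Space → Space} (hu : ContDiffAt ℝ 2 u x) (i : Fin 3) :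
    Laplacian.laplacian u x i = Laplacian.laplacian (fun y => u y i) x :=
  (hu.laplacian_CLM_comp_left (l := (EuclideanSpace.proj i : Space →L[ℝ] ℝ))).symm

theorem laplacian_eq_zero_iff {u : Space → Space} (hu : ContDiffAt ℝ 2 u x) :
    Laplacian.laplacian u x = 0 ↔ ∀ k, ∑ i, pd i (pd i (fun y => u y k)) x = 0 := by
  have hk : ∀ k, ContDiffAt ℝ 2 (fun y => u y k) x := fun k =>
    (EuclideanSpace.proj k : Space →L[ℝ] ℝ).contDiff.contDiffAt.comp x hu
  simp_rw [← laplacian_eq_sum_pd (hk _), ← laplacian_apply hu]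
  constructor
  · intro h k
    simp [h]
  · intro h
    ext k
    exact h k

/-- Adjacent transpositions generate the symmetric group. For iterated partial derivatives, it is
thus enough to exchange two neighbouring ones. -/
theorem comp_perm_of_adjacent_swaps {α β : Type*} {n : ℕ} (T : (Fin (n + 1) → α) → β)
    (h : ∀ (i : Fin n) v, T (v ∘ Equiv.swap i.castSucc i.succ) = T v)
    (σ : Equiv.Perm (Fin (n + 1))) (v : Fin (n + 1) → α) : T (v ∘ σ) = T v := by
  have hσ : σ ∈ Submonoid.closure
      (Set.range fun i : Fin n => Equiv.swap i.castSucc i.succ) := by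
    rw [Equiv.Perm.mclosure_swap_castSucc_succ]
    trivial
  induction hσ using Submonoid.closure_induction generalizing v with
  | mem τ hτ =>
    obtain ⟨i, rfl⟩ := hτ
    exact h i v
  | one => rfl
  | mul τ ρ _ _ h₁ h₂ =>
    rw [Equiv.Perm.coe_mul, ← Function.comp_assoc, h₂, h₁]

theorem pd_pd_comp_perm (hΩ : IsOpen Ω) (hf : ContDiffOn ℝ 2 f Ω) (hx : x ∈ Ω)
    (σ : Equiv.Perm (Fin 2)) (v : Fin 2 → Fin 3) :
    pd (v (σ 0)) (pd (v (σ 1)) f) x = pd (v 0) (pd (v 1) f) x := by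
  refine comp_perm_of_adjacent_swaps (fun v => pd (v 0) (pd (v 1) f) x) ?_ σ v
  intro i v
  fin_cases i
  exact pd_comm (hf.contDiffAt (hΩ.mem_nhds hx)) _ _

theorem pd_four_comp_perm (hΩ : IsOpen Ω) (hf : ContDiffOn ℝ 4 f Ω) (hx : x ∈ Ω)
    (σ : Equiv.Perm (Fin 4)) (v : Fin 4 → Fin 3) :
    pd (v (σ 0)) (pd (v (σ 1)) (pd (v (σ 2)) (pd (v (σ 3)) f))) x =
      pd (v 0) (pd (v 1) (pd (v 2) (pd (v 3) f))) x := by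
  refine comp_perm_of_adjacent_swaps
    (fun v => pd (v 0) (pd (v 1) (pd (v 2) (pd (v 3) f))) x) ?_ σ v
  have h3 := fun i => contDiffOn_pd (m := 3) hΩ hf (by norm_num) i
  have h2 := fun i j => contDiffOn_pd (m := 2) hΩ (h3 j) (by norm_num) i
  intro i v
  fin_cases i
  · exact pd_comm ((h2 _ _).contDiffAt (hΩ.mem_nhds hx)) _ _
  · exact pd_congr hΩ (fun y hy => pd_comm (((h3 _).of_le (by norm_num)).contDiffAt
      (hΩ.mem_nhds hy)) _ _) hx _
  · exact pd_congr hΩ (fun y hy => pd_congr hΩ (fun z hz => pd_comm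
      ((hf.of_le (by norm_num)).contDiffAt (hΩ.mem_nhds hz)) _ _) hy _) hx _

end Calculus

/-! ### Multilinear forms, polarization and isotropic symbols. -/

section Tensors

theorem sum_fin_succ_fun {α : Type*} [Fintype α] {n : ℕ} (F : (Fin (n + 1) → α) → ℝ) :
    ∑ v, F v = ∑ a, ∑ w : Fin n → α, F (Matrix.vecCons a w) := by
  rw [← (Fin.consEquiv fun _ => α).sum_comp, Fintype.sum_prod_type]
  rfl

theorem sum_fin_two_fun (F : (Fin 2 → Fin 3) → ℝ) : ∑ v, F v = ∑ i, ∑ j, F ![i, j] := by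
  simp only [sum_fin_succ_fun, Fintype.sum_unique]
  congr!

theorem sum_fin_four_fun (F : (Fin 4 → Fin 3) → ℝ) :
    ∑ v, F v = ∑ i, ∑ j, ∑ k, ∑ l, F ![i, j, k, l] := by
  simp only [sum_fin_succ_fun, Fintype.sum_unique]
  congr!

theorem sum_fin_six_fun (F : (Fin 6 → Fin 3) → ℝ) :
    ∑ v, F v = ∑ i, ∑ j, ∑ k, ∑ l, ∑ m, ∑ n, F ![i, j, k, l, m, n] := by
  simp only [sum_fin_succ_fun, Fintype.sum_unique]
  congr!

/-- The multilinear form with components `T`. -/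
def form {r : ℕ} (T : (Fin r → Fin 3) → ℝ) (a : Fin r → Fin 3 → ℝ) : ℝ :=
  ∑ v, T v * ∏ i, a i (v i)

theorem form_mulVec {r : ℕ} {T : (Fin r → Fin 3) → ℝ} {Q : Matrix (Fin 3) (Fin 3) ℝ}
    (hT : ∀ v, ∑ w, (∏ i, Q (v i) (w i)) * T w = T v) (hQ : Q.transpose * Q = 1)
    (a : Fin r → Fin 3 → ℝ) : form T (fun i => Q.mulVec (a i)) = form T a := by
  have h : ∀ b : Fin r → Fin 3 → ℝ, form T b = form T fun i => Q.transpose.mulVec (b i) := by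
    intro b
    unfold form
    conv_lhs => enter [2, v]; rw [← hT v, Finset.sum_mul]
    rw [Finset.sum_comm]
    refine Finset.sum_congr rfl fun w _ => ?_
    simp only [Matrix.mulVec, dotProduct, Matrix.transpose_apply]
    rw [Finset.prod_univ_sum, Finset.mul_sum]
    simp only [Fintype.piFinset_univ, Finset.prod_mul_distrib]
    exact Finset.sum_congr rfl fun v _ => by ring
  rw [h]
  simp [Matrix.mulVec_mulVec, hQ]

/-- Polarization: the r-th derivative at 0 of the diagonal restriction of a multilinear form is its
sum over all permutations of the arguments. The polynomial of `D` vanishes, so the symmetrization of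
`D` does too, and a symmetric `T` pairs only with that symmetrization. With `T` an iterated
derivative, an operator with zero symbol is zero. -/
theorem sum_mul_eq_zero_of_symmetric {r : ℕ} {D T : (Fin r → Fin 3) → ℝ}
    (hD : ∀ ξ : Fin 3 → ℝ, ∑ v, D v * ∏ i, ξ (v i) = 0)
    (hT : ∀ (σ : Equiv.Perm (Fin r)) v, T (v ∘ σ) = T v) : ∑ v, D v * T v = 0 := by
  let f : ContinuousMultilinearMap ℝ (fun _ : Fin r => Fin 3 → ℝ) ℝ :=
    ∑ v, D v • (ContinuousMultilinearMap.mkPiAlgebra ℝ (Fin r) ℝ).compContinuousLinearMap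
      fun i => ContinuousLinearMap.proj (v i)
  have hf : ∀ a, f a = ∑ v, D v * ∏ i, a i (v i) := by
    intro a
    simp [f]
  have hsymm : ∀ w : Fin r → Fin 3, ∑ σ : Equiv.Perm (Fin r), D (w ∘ σ) = 0 := by
    intro w
    have h := f.iteratedFDeriv_comp_diagonal 0 (fun i => Pi.single (w i) (1 : ℝ))
    have h0 : (fun x => f fun _ => x) = fun _ => (0 : ℝ) := by
      ext ξ
      rw [hf, hD]
    rw [h0] at h
    have hz : iteratedFDeriv ℝ r (fun _ : Fin 3 → ℝ => (0 : ℝ)) 0 = 0 := by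
      rw [iteratedFDeriv_fun_zero]; rfl
    rw [hz] at h
    refine Eq.trans (Finset.sum_congr rfl fun σ _ => ?_) h.symm
    rw [hf]
    simp only [Pi.single_apply, Finset.prod_ite_zero, Finset.prod_const_one]
    -- On basis vectors the form returns a single component of `D`.
    rw [Finset.sum_eq_single (w ∘ σ)]
    · simp
    · intro v _ hv
      rw [if_neg, mul_zero]
      intro h
      exact hv (funext fun i => h i (Finset.mem_univ _))
    · simp
  have hperm : ∀ σ : Equiv.Perm (Fin r), ∑ v, D v * T v = ∑ v, D (v ∘ σ) * T v := by
    intro σ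
    rw [← (Equiv.arrowCongr σ.symm (Equiv.refl (Fin 3))).sum_comp]
    refine Finset.sum_congr rfl fun v _ => ?_
    have : (Equiv.arrowCongr σ.symm (Equiv.refl (Fin 3))) v = v ∘ σ := by
      ext; simp [Equiv.arrowCongr]
    rw [this, hT]
  have hcard : (Fintype.card (Equiv.Perm (Fin r)) : ℝ) * ∑ v, D v * T v = 0 := by
    calc _ = ∑ σ : Equiv.Perm (Fin r), ∑ v, D v * T v := by simp
      _ = ∑ σ : Equiv.Perm (Fin r), ∑ v, D (v ∘ σ) * T v :=
        Finset.sum_congr rfl fun σ _ => hperm σ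
      _ = 0 := by
        rw [Finset.sum_comm]
        simp [← Finset.sum_mul, hsymm]
  exact (mul_eq_zero.mp hcard).resolve_left (by simp [Fintype.card_ne_zero])

/-- Householder reflection in the plane orthogonal to v = ξ - |ξ| e₀, or the identity if v = 0. -/
theorem exists_orthogonal_mulVec_eq (ξ : Fin 3 → ℝ) :
    ∃ (Q : Matrix (Fin 3) (Fin 3) ℝ) (r : ℝ), Q.transpose * Q = 1 ∧ r ^ 2 = ξ ⬝ᵥ ξ ∧
      Q.mulVec ξ = r • Pi.single 0 1 := by
  have hnn : 0 ≤ ξ ⬝ᵥ ξ := by simpa using dotProduct_star_self_nonneg ξ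
  set r := Real.sqrt (ξ ⬝ᵥ ξ) with hr
  have hr2 : r ^ 2 = ξ ⬝ᵥ ξ := Real.sq_sqrt hnn
  set v : Fin 3 → ℝ := ξ - r • Pi.single 0 1 with hv
  by_cases hv0 : v = 0
  · refine ⟨1, r, by simp, hr2, ?_⟩
    rw [Matrix.one_mulVec]
    exact sub_eq_zero.mp hv0
  · have hvv : v ⬝ᵥ v ≠ 0 := by simpa using hv0
    -- This holds because ξ and r e₀ have equal length; it makes the reflection subtract exactly v
    -- from ξ.
    have h2 : v ⬝ᵥ v = 2 * (v ⬝ᵥ ξ) := by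
      simp only [hv, sub_dotProduct, dotProduct_sub, smul_dotProduct, dotProduct_smul,
        smul_eq_mul, single_dotProduct, dotProduct_single, ← hr2]
      simp
      ring
    refine ⟨1 - (2 / (v ⬝ᵥ v)) • Matrix.vecMulVec v v, r, ?_, hr2, ?_⟩
    · have hm : Matrix.vecMulVec v v * Matrix.vecMulVec v v =
          (v ⬝ᵥ v) • Matrix.vecMulVec v v := by
        ext i j
        simp [Matrix.mul_apply, Matrix.vecMulVec_apply, dotProduct, Fin.sum_univ_three]
        ring
      have ht : (Matrix.vecMulVec v v).transpose = Matrix.vecMulVec v v := by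
        ext i j
        simp [Matrix.vecMulVec_apply, mul_comm]
      simp only [Matrix.transpose_sub, Matrix.transpose_one, Matrix.transpose_smul, ht, mul_sub,
        sub_mul, mul_one, one_mul, Matrix.smul_mul, Matrix.mul_smul, hm, smul_smul]
      rw [show 2 / (v ⬝ᵥ v) * (2 / (v ⬝ᵥ v) * (v ⬝ᵥ v)) = 2 / (v ⬝ᵥ v) + 2 / (v ⬝ᵥ v) by
        field_simp; ring, add_smul]
      abel
    · have hm : (Matrix.vecMulVec v v).mulVec ξ = (v ⬝ᵥ ξ) • v := by
        ext i
        simp [Matrix.mulVec, Matrix.vecMulVec_apply, dotProduct, Fin.sum_univ_three]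
        ring
      rw [Matrix.sub_mulVec, Matrix.one_mulVec, Matrix.smul_mulVec, hm, smul_smul, h2,
        show 2 / (2 * (v ⬝ᵥ ξ)) * (v ⬝ᵥ ξ) = 1 by
          have : v ⬝ᵥ ξ ≠ 0 := fun h => hvv (by rw [h2, h, mul_zero])
          field_simp]
      simp [hv]

/-- An isotropic matrix-valued homogeneous function of even degree on `ℝ³` is a combination of
`|ξ|² I` and `ξ ⊗ ξ`, up to a power of `|ξ|²`. -/
theorem isotropic_bilin_eq {p : (Fin 3 → ℝ) → (Fin 3 → ℝ) →ₗ[ℝ] (Fin 3 → ℝ) →ₗ[ℝ] ℝ} {s : ℕ}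
    (hinv : ∀ Q : Matrix (Fin 3) (Fin 3) ℝ, Q.transpose * Q = 1 → ∀ ξ η ζ,
      p (Q.mulVec ξ) (Q.mulVec η) (Q.mulVec ζ) = p ξ η ζ)
    (hhom : ∀ (t : ℝ) ξ η ζ, p (t • ξ) η ζ = t ^ (2 * s + 2) * p ξ η ζ) :
    ∃ a b : ℝ, ∀ ξ η ζ, p ξ η ζ =
      a * (ξ ⬝ᵥ ξ) ^ (s + 1) * (η ⬝ᵥ ζ) + b * (ξ ⬝ᵥ ξ) ^ s * (ξ ⬝ᵥ η) * (ξ ⬝ᵥ ζ) := by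
  let e : Fin 3 → Fin 3 → ℝ := fun i => Pi.single i 1
  -- Reversing an axis other than the first fixes e₀ and changes the sign of every off-diagonal
  -- entry involving that axis.
  have hflip : ∀ i j k : Fin 3, k ≠ 0 → i ≠ k → j = k → p (e 0) (e i) (e j) = 0 ∧
      p (e 0) (e j) (e i) = 0 := by
    rintro i j k hk hi rfl
    have h := hinv (Matrix.diagonal (Function.update 1 j (-1))) (by
      rw [Matrix.diagonal_transpose, Matrix.diagonal_mul_diagonal, ← Matrix.diagonal_one]
      congr 1
      ext l
      by_cases h : l = j <;> simp [h])
    have hm : ∀ l, (Matrix.diagonal (Function.update (1 : Fin 3 → ℝ) j (-1))).mulVec (e l) =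
        (if l = j then -1 else 1 : ℝ) • e l := by
      intro l
      ext m
      by_cases hlm : l = m
      · subst hlm
        simp [e, Matrix.mulVec_diagonal, Function.update_apply]
      · have hml : m ≠ l := fun h => hlm h.symm
        simp [e, Matrix.mulVec_diagonal, hml]
    have h1 := h (e 0) (e i) (e j)
    have h2 := h (e 0) (e j) (e i)
    simp only [hm, hk.symm, hi, if_true, if_false, one_smul, neg_smul, map_neg,
      LinearMap.neg_apply] at h1 h2
    constructor <;> linarith
  -- Exchanging the two transverse axes also fixes e₀, so the transverse diagonal entries agree.
  have hswap : p (e 0) (e 2) (e 2) = p (e 0) (e 1) (e 1) := by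
    have h := hinv !![1, 0, 0; 0, 0, 1; 0, 1, 0] (by
      ext i j
      fin_cases i <;> fin_cases j <;> simp [Matrix.mul_apply, Fin.sum_univ_three])
      (e 0) (e 1) (e 1)
    have h0 : Matrix.mulVec !![1, 0, 0; 0, 0, 1; 0, 1, 0] (e 0) = e 0 := by
      ext i
      fin_cases i <;> simp [e, Matrix.mulVec, dotProduct, Fin.sum_univ_three]
    have h1 : Matrix.mulVec !![1, 0, 0; 0, 0, 1; 0, 1, 0] (e 1) = e 2 := by
      ext i
      fin_cases i <;> simp [e, Matrix.mulVec, dotProduct, Fin.sum_univ_three]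
    rwa [h0, h1] at h
  have hexp : ∀ η ζ, p (e 0) η ζ = p (e 0) (e 1) (e 1) * (η ⬝ᵥ ζ) +
      (p (e 0) (e 0) (e 0) - p (e 0) (e 1) (e 1)) * η 0 * ζ 0 := by
    intro η ζ
    have hη : ∀ η : Fin 3 → ℝ, η = η 0 • e 0 + η 1 • e 1 + η 2 • e 2 := by
      intro η
      ext i
      fin_cases i <;> simp [e]
    conv_lhs => rw [hη η, hη ζ]
    simp only [map_add, map_smul, LinearMap.add_apply, LinearMap.smul_apply, smul_eq_mul,
      dotProduct, Fin.sum_univ_three]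
    rw [(hflip 0 1 1 (by decide) (by decide) rfl).1, (hflip 0 1 1 (by decide) (by decide) rfl).2,
      (hflip 0 2 2 (by decide) (by decide) rfl).1, (hflip 0 2 2 (by decide) (by decide) rfl).2,
      (hflip 1 2 2 (by decide) (by decide) rfl).1, (hflip 1 2 2 (by decide) (by decide) rfl).2,
      hswap]
    ring
  refine ⟨p (e 0) (e 1) (e 1), p (e 0) (e 0) (e 0) - p (e 0) (e 1) (e 1), fun ξ η ζ => ?_⟩
  -- Homogeneity turns p(r e₀) into r^(2s+2) p(e₀). In the second term, two factors r are absorbed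
  -- by r(Qη)₀ = ξ·η and r(Qζ)₀ = ξ·ζ, so no division by |ξ| occurs and ξ = 0 needs no separate
  -- case.
  obtain ⟨Q, r, hQ, hr, hξ⟩ := exists_orthogonal_mulVec_eq ξ
  have hdot : ∀ η ζ : Fin 3 → ℝ, Q.mulVec η ⬝ᵥ Q.mulVec ζ = η ⬝ᵥ ζ := by
    intro η ζ
    rw [Matrix.dotProduct_mulVec, Matrix.vecMul_mulVec, hQ, Matrix.vecMul_one]
  have hcoord : ∀ η, r * (Q.mulVec η) 0 = ξ ⬝ᵥ η := by
    intro η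
    rw [← hdot ξ η, hξ]
    simp [smul_dotProduct, single_dotProduct]
  rw [← hinv Q hQ ξ η ζ, hξ, hhom, hexp, hdot, ← hcoord η, ← hcoord ζ, ← hr]
  ring

end Tensors

/-! ### Symbols of isotropic elasticity tensors, and the class O(3). -/

section IsotropicTensors

/-- The quartilinear form with components `C`. -/
def form4 (C : Tensor4) (a b c d : Fin 3 → ℝ) : ℝ :=
  ∑ i, ∑ j, ∑ k, ∑ l, C i j k l * (a i * b j * c k * d l)

/-- The six-linear form with components `A`. -/
def form6 (A : Tensor6) (a b c d e f : Fin 3 → ℝ) : ℝ :=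
  ∑ i, ∑ j, ∑ k, ∑ l, ∑ m, ∑ n, A i j k l m n * (a i * b j * c k * d l * e m * f n)

theorem mem_orthogonalGroup_of_transpose_mul {Q : Matrix (Fin 3) (Fin 3) ℝ}
    (hQ : Q.transpose * Q = 1) : Q ∈ Matrix.orthogonalGroup (Fin 3) ℝ :=
  (Matrix.mem_orthogonalGroup_iff' (Fin 3) ℝ).mpr hQ

theorem form4_mulVec {C : Tensor4} (hC : symmetryGroup4 C = Set.univ)
    {Q : Matrix (Fin 3) (Fin 3) ℝ} (hQ : Q.transpose * Q = 1) (a b c d : Fin 3 → ℝ) :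
    form4 C (Q.mulVec a) (Q.mulVec b) (Q.mulVec c) (Q.mulVec d) = form4 C a b c d := by
  have hrot : rotate4 Q C = C := by
    have : (⟨Q, mem_orthogonalGroup_of_transpose_mul hQ⟩ : Matrix.orthogonalGroup (Fin 3) ℝ) ∈
      symmetryGroup4 C := hC ▸ Set.mem_univ _
    exact this
  have h := form_mulVec (r := 4) (T := fun v => C (v 0) (v 1) (v 2) (v 3)) (Q := Q) (by
    intro v
    rw [sum_fin_four_fun]
    conv_rhs => rw [← hrot]
    simp [rotate4, Fin.prod_univ_four]) hQ ![a, b, c, d]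
  simpa [form, form4, sum_fin_four_fun, Fin.prod_univ_four] using h

theorem form6_mulVec {A : Tensor6} (hA : symmetryGroup6 A = Set.univ)
    {Q : Matrix (Fin 3) (Fin 3) ℝ} (hQ : Q.transpose * Q = 1) (a b c d e f : Fin 3 → ℝ) :
    form6 A (Q.mulVec a) (Q.mulVec b) (Q.mulVec c) (Q.mulVec d) (Q.mulVec e) (Q.mulVec f) =
      form6 A a b c d e f := by
  have hrot : rotate6 Q A = A := by
    have : (⟨Q, mem_orthogonalGroup_of_transpose_mul hQ⟩ : Matrix.orthogonalGroup (Fin 3) ℝ) ∈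
      symmetryGroup6 A := hA ▸ Set.mem_univ _
    exact this
  have h := form_mulVec (r := 6) (T := fun v => A (v 0) (v 1) (v 2) (v 3) (v 4) (v 5)) (Q := Q) (by
    intro v
    rw [sum_fin_six_fun]
    conv_rhs => rw [← hrot]
    simp [rotate6, Fin.prod_univ_six]) hQ ![a, b, c, d, e, f]
  simpa [form, form6, sum_fin_six_fun, Fin.prod_univ_six] using h

/-- The sum is the symbol of u ↦ σ_{ik,i}: the derivative slots receive ξ, and the free slots k, l
form an isotropic bilinear form. -/
theorem exists_isotropic_symbol4 {C : Tensor4} (hC : symmetryGroup4 C = Set.univ) :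
    ∃ a b : ℝ, ∀ (k l : Fin 3) (ξ : Fin 3 → ℝ), ∑ i, ∑ j, C i k l j * (ξ i * ξ j) =
      a * (ξ ⬝ᵥ ξ) * (if k = l then 1 else 0) + b * ξ k * ξ l := by
  obtain ⟨a, b, h⟩ := isotropic_bilin_eq (s := 0)
    (p := fun ξ => LinearMap.mk₂ ℝ (fun η ζ => form4 C ξ η ζ ξ)
      (fun _ _ _ => by simp only [form4, Pi.add_apply, mul_add, add_mul, Finset.sum_add_distrib])
      (fun c η ζ => by
        simp only [form4, Pi.smul_apply, smul_eq_mul, Finset.mul_sum]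
        congr! 4; ring)
      (fun _ _ _ => by simp only [form4, Pi.add_apply, mul_add, add_mul, Finset.sum_add_distrib])
      (fun c η ζ => by
        simp only [form4, Pi.smul_apply, smul_eq_mul, Finset.mul_sum]
        congr! 4; ring))
    (fun Q hQ ξ η ζ => form4_mulVec hC hQ _ _ _ _)
    (fun t ξ η ζ => by
      simp only [LinearMap.mk₂_apply, form4, Pi.smul_apply, smul_eq_mul, Finset.mul_sum]
      congr! 4; ring)
  refine ⟨a, b, fun k l ξ => ?_⟩
  have h' := h ξ (Pi.single k 1) (Pi.single l 1)
  simp only [LinearMap.mk₂_apply, form4, Pi.single_apply, dotProduct_single, mul_ite, mul_one,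
    mul_zero, ite_mul, zero_mul, Finset.sum_ite_irrel, Finset.sum_const_zero,
    Finset.sum_ite_eq', Finset.mem_univ, if_true, zero_add, pow_one, pow_zero] at h'
  simp only [eq_comm (a := l)] at h'
  rw [mul_ite, mul_one, mul_zero, ← h']

/-- Only invariance of the form is assumed, with no index symmetry, so that the lemma also applies
to `A` with permuted slots. -/
theorem exists_isotropic_symbol6_of_form6 {A : Tensor6}
    (hA : ∀ Q : Matrix (Fin 3) (Fin 3) ℝ, Q.transpose * Q = 1 → ∀ a b c d e f,
      form6 A (Q.mulVec a) (Q.mulVec b) (Q.mulVec c) (Q.mulVec d) (Q.mulVec e) (Q.mulVec f) =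
        form6 A a b c d e f) :
    ∃ a b : ℝ, ∀ (k l : Fin 3) (ξ : Fin 3 → ℝ),
      ∑ i, ∑ j, ∑ m, ∑ n, A i k j l n m * (ξ i * ξ j * ξ m * ξ n) =
      a * (ξ ⬝ᵥ ξ) ^ 2 * (if k = l then 1 else 0) + b * (ξ ⬝ᵥ ξ) * ξ k * ξ l := by
  obtain ⟨a, b, h⟩ := isotropic_bilin_eq (s := 1)
    (p := fun ξ => LinearMap.mk₂ ℝ (fun η ζ => form6 A ξ η ξ ζ ξ ξ)
      (fun _ _ _ => by simp only [form6, Pi.add_apply, mul_add, add_mul, Finset.sum_add_distrib])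
      (fun c η ζ => by
        simp only [form6, Pi.smul_apply, smul_eq_mul, Finset.mul_sum]
        congr! 6; ring)
      (fun _ _ _ => by simp only [form6, Pi.add_apply, mul_add, add_mul, Finset.sum_add_distrib])
      (fun c η ζ => by
        simp only [form6, Pi.smul_apply, smul_eq_mul, Finset.mul_sum]
        congr! 6; ring))
    (fun Q hQ ξ η ζ => hA Q hQ _ _ _ _ _ _)
    (fun t ξ η ζ => by
      simp only [LinearMap.mk₂_apply, form6, Pi.smul_apply, smul_eq_mul, Finset.mul_sum]
      congr! 6; ring)
  refine ⟨a, b, fun k l ξ => ?_⟩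
  have h' := h ξ (Pi.single k 1) (Pi.single l 1)
  simp only [LinearMap.mk₂_apply, form6, Pi.single_apply, dotProduct_single, mul_ite, mul_one,
    mul_zero, ite_mul, zero_mul, Finset.sum_ite_irrel, Finset.sum_const_zero,
    Finset.sum_ite_eq', Finset.mem_univ, if_true, pow_one] at h'
  simp only [eq_comm (a := l)] at h'
  rw [mul_ite, mul_one, mul_zero]
  refine Eq.trans ?_ h'
  refine Finset.sum_congr rfl fun i _ => Finset.sum_congr rfl fun j _ => ?_
  rw [Finset.sum_comm]
  congr! 2; ring

theorem exists_isotropic_symbol6 {A : Tensor6} (hA : symmetryGroup6 A = Set.univ) :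
    ∃ a b : ℝ, ∀ (k l : Fin 3) (ξ : Fin 3 → ℝ),
      ∑ i, ∑ j, ∑ m, ∑ n, A i k j l n m * (ξ i * ξ j * ξ m * ξ n) =
      a * (ξ ⬝ᵥ ξ) ^ 2 * (if k = l then 1 else 0) + b * (ξ ⬝ᵥ ξ) * ξ k * ξ l :=
  exists_isotropic_symbol6_of_form6 fun _ hQ => form6_mulVec hA hQ

/-- The symbol of τ_{ijk,ij}, where both divergences fall on the strain slots. It is the previous
symbol for `A` with its second and third slots exchanged. -/
theorem exists_isotropic_symbol6' {A : Tensor6} (hA : symmetryGroup6 A = Set.univ) :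
    ∃ a b : ℝ, ∀ (k l : Fin 3) (ξ : Fin 3 → ℝ),
      ∑ i, ∑ j, ∑ m, ∑ n, A i j k l n m * (ξ i * ξ j * ξ m * ξ n) =
      a * (ξ ⬝ᵥ ξ) ^ 2 * (if k = l then 1 else 0) + b * (ξ ⬝ᵥ ξ) * ξ k * ξ l := by
  have hswap : ∀ a b c d e f, form6 (fun i k j => A i j k) a b c d e f = form6 A a c b d e f := by
    intro a b c d e f
    refine Finset.sum_congr rfl fun i _ => ?_
    rw [Finset.sum_comm]
    congr! 5; ring
  exact exists_isotropic_symbol6_of_form6 (A := fun i k j => A i j k) fun Q hQ a b c d e f => by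
    simp only [hswap, form6_mulVec hA hQ]

theorem neg_one_mem_orthogonalGroup :
    (-1 : Matrix (Fin 3) (Fin 3) ℝ) ∈ Matrix.orthogonalGroup (Fin 3) ℝ :=
  mem_orthogonalGroup_of_transpose_mul (by simp)

theorem rotate5_neg_one (M : Tensor5) : rotate5 (-1) M = -M := by
  ext i j k l m
  simp [rotate5, Matrix.one_apply]

/-- The central inversion acts on tensors of odd order as multiplication by -1. -/
theorem symmetryGroup5_eq_univ_iff (M : Tensor5) : symmetryGroup5 M = Set.univ ↔ M = 0 := by
  constructor
  · intro h
    have hmem : (⟨-1, neg_one_mem_orthogonalGroup⟩ : Matrix.orthogonalGroup (Fin 3) ℝ) ∈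
      symmetryGroup5 M := h ▸ Set.mem_univ _
    have h1 : rotate5 (-1) M = M := hmem
    rw [rotate5_neg_one] at h1
    ext i j k l m
    have := congrFun (congrFun (congrFun (congrFun (congrFun h1 i) j) k) l) m
    simp only [Pi.neg_apply] at this
    simp only [Pi.zero_apply]
    linarith
  · rintro rfl
    ext Q
    simp only [symmetryGroup5, Set.mem_ofPred_eq, Set.mem_univ, iff_true]
    ext i j k l m
    simp [rotate5]

theorem Material.isClassO3_iff (L : Material) :
    L.IsClassO3 ↔ L.M = 0 ∧ symmetryGroup4 L.C = Set.univ ∧ symmetryGroup6 L.A = Set.univ := by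
  rw [Material.IsClassO3, Material.symmetryGroup, ← symmetryGroup5_eq_univ_iff]
  simp only [Set.eq_univ_iff_forall, Set.mem_inter_iff, forall_and]
  tauto

end IsotropicTensors

/-! ### Equilibrium for isotropic materials and the two differential conditions. -/

section Equilibrium

variable {Ω : Set Space} {u : Space → Space} {x : Space}

theorem contDiffOn_coord {n : WithTop ℕ∞} (hu : ContDiffOn ℝ n u Ω) (k : Fin 3) :
    ContDiffOn ℝ n (fun y => u y k) Ω :=
  (EuclideanSpace.proj k : Space →L[ℝ] ℝ).contDiff.comp_contDiffOn hu

/-- The operator has the same symbol as aΔf_k + b ∂_k div f. The two may differ in coefficients, but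
not on commuting derivatives. -/
theorem sum_pd_pd_eq_zero (hΩ : IsOpen Ω) {G : Fin 3 → Fin 3 → Fin 3 → ℝ} {k : Fin 3} {a b : ℝ}
    (hG : ∀ l (ξ : Fin 3 → ℝ), ∑ i, ∑ j, G l i j * (ξ i * ξ j) =
      a * (ξ ⬝ᵥ ξ) * (if k = l then 1 else 0) + b * ξ k * ξ l)
    {f : Fin 3 → Space → ℝ} (hf : ∀ l, ContDiffOn ℝ 2 (f l) Ω)
    (hlap : ∀ y ∈ Ω, ∑ i, pd i (pd i (f k)) y = 0)
    (hdiv : ∀ y ∈ Ω, ∑ l, pd k (pd l (f l)) y = 0) (hx : x ∈ Ω) :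
    ∑ l, ∑ i, ∑ j, G l i j * pd i (pd j (f l)) x = 0 := by
  have h : ∀ l, ∑ i, ∑ j, (G l i j - (a * (if k = l then 1 else 0) * (if i = j then 1 else 0) +
      b * (if i = k then 1 else 0) * (if j = l then 1 else 0))) * pd i (pd j (f l)) x = 0 := by
    intro l
    have := sum_mul_eq_zero_of_symmetric (r := 2)
      (D := fun v => G l (v 0) (v 1) - (a * (if k = l then 1 else 0) *
        (if v 0 = v 1 then 1 else 0) +
        b * (if v 0 = k then 1 else 0) * (if v 1 = l then 1 else 0)))
      (T := fun v => pd (v 0) (pd (v 1) (f l)) x) (by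
        intro ξ
        simp only [sum_fin_two_fun, Fin.prod_univ_two, sub_mul, Finset.sum_sub_distrib]
        refine sub_eq_zero.mpr ((hG l ξ).trans ?_)
        change _ = ∑ i, ∑ j, (a * (if k = l then 1 else 0) * (if i = j then 1 else 0) +
          b * (if i = k then 1 else 0) * (if j = l then 1 else 0)) * (ξ i * ξ j)
        simp only [add_mul, Finset.sum_add_distrib,
          mul_ite, ite_mul, mul_one, mul_zero, zero_mul, Finset.sum_ite_eq, Finset.sum_ite_eq',
          Finset.sum_ite_irrel, Finset.sum_const_zero, Finset.mem_univ, if_true]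
        simp only [dotProduct, Fin.sum_univ_three]
        split_ifs <;> ring)
      (fun σ v => pd_pd_comp_perm hΩ (hf l) hx σ v)
    rw [sum_fin_two_fun] at this
    exact this
  simp only [sub_mul, Finset.sum_sub_distrib, sub_eq_zero] at h
  simp only [h]
  have h1 := hlap x hx
  have h2 := hdiv x hx
  simp [add_mul, Finset.sum_add_distrib, ← Finset.mul_sum, h1, h2]

/-- Here the operator equals Δ(aΔf_k + b ∂_k div f). The common factor |ξ|² in the symbol is what
makes the second-order conditions suffice. -/
theorem sum_pd_four_eq_zero (hΩ : IsOpen Ω) {G : Fin 3 → Fin 3 → Fin 3 → Fin 3 → Fin 3 → ℝ}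
    {k : Fin 3} {a b : ℝ}
    (hG : ∀ l (ξ : Fin 3 → ℝ), ∑ i, ∑ j, ∑ m, ∑ n, G l i j m n * (ξ i * ξ j * ξ m * ξ n) =
      a * (ξ ⬝ᵥ ξ) ^ 2 * (if k = l then 1 else 0) + b * (ξ ⬝ᵥ ξ) * ξ k * ξ l)
    {f : Fin 3 → Space → ℝ} (hf : ∀ l, ContDiffOn ℝ 4 (f l) Ω)
    (hlap : ∀ y ∈ Ω, ∑ i, pd i (pd i (f k)) y = 0)
    (hdiv : ∀ y ∈ Ω, ∑ l, pd k (pd l (f l)) y = 0) (hx : x ∈ Ω) :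
    ∑ l, ∑ i, ∑ j, ∑ m, ∑ n, G l i j m n * pd i (pd j (pd m (pd n (f l)))) x = 0 := by
  have h : ∀ l, ∑ i, ∑ j, ∑ m, ∑ n, (G l i j m n -
      (a * (if k = l then 1 else 0) * (if i = j then 1 else 0) * (if m = n then 1 else 0) +
      b * (if i = j then 1 else 0) * (if m = k then 1 else 0) * (if n = l then 1 else 0))) *
      pd i (pd j (pd m (pd n (f l)))) x = 0 := by
    intro l
    have := sum_mul_eq_zero_of_symmetric (r := 4)
      (D := fun v => G l (v 0) (v 1) (v 2) (v 3) - (a * (if k = l then 1 else 0) *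
        (if v 0 = v 1 then 1 else 0) * (if v 2 = v 3 then 1 else 0) +
        b * (if v 0 = v 1 then 1 else 0) * (if v 2 = k then 1 else 0) *
          (if v 3 = l then 1 else 0)))
      (T := fun v => pd (v 0) (pd (v 1) (pd (v 2) (pd (v 3) (f l)))) x) (by
        intro ξ
        simp only [sum_fin_four_fun, Fin.prod_univ_four, sub_mul, Finset.sum_sub_distrib]
        refine sub_eq_zero.mpr ((hG l ξ).trans ?_)
        change _ = ∑ i, ∑ j, ∑ m, ∑ n, (a * (if k = l then 1 else 0) * (if i = j then 1 else 0) *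
            (if m = n then 1 else 0) + b * (if i = j then 1 else 0) * (if m = k then 1 else 0) *
            (if n = l then 1 else 0)) * (ξ i * ξ j * ξ m * ξ n)
        simp only [add_mul, Finset.sum_add_distrib,
          mul_ite, ite_mul, mul_one, mul_zero, zero_mul, Finset.sum_ite_eq, Finset.sum_ite_eq',
          Finset.sum_ite_irrel, Finset.sum_const_zero, Finset.mem_univ, if_true]
        simp only [dotProduct, Fin.sum_univ_three]
        split_ifs <;> ring)
      (fun σ v => pd_four_comp_perm hΩ (hf l) hx σ v)
    rw [sum_fin_four_fun] at this
    exact this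
  simp only [sub_mul, Finset.sum_sub_distrib, sub_eq_zero] at h
  simp only [h]
  have c2 : ∀ m n l, ContDiffOn ℝ 2 (pd m (pd n (f l))) Ω := fun m n l =>
    contDiffOn_pd hΩ (contDiffOn_pd (m := 3) hΩ (hf l) (by norm_num) n) (by norm_num) m
  have c1 : ∀ i m n l, ContDiffOn ℝ 1 (pd i (pd m (pd n (f l)))) Ω := fun i m n l =>
    contDiffOn_pd hΩ (c2 m n l) (by norm_num) i
  have hcomm : ∀ (i : Fin 3) (F : Fin 3 → Space → ℝ), (∀ l, ContDiffOn ℝ 2 (F l) Ω) →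
      (∀ y ∈ Ω, ∑ l, F l y = 0) → ∑ l, pd i (pd i (F l)) x = 0 := by
    intro i F hF h0
    have hd : ∀ l, ∀ y ∈ Ω, DifferentiableAt ℝ (F l) y := fun l y hy =>
      differentiableAt_of_contDiffOn hΩ (hF l) (by norm_num) hy
    have hd' : ∀ l, ∀ y ∈ Ω, DifferentiableAt ℝ (pd i (F l)) y := fun l y hy =>
      differentiableAt_of_contDiffOn hΩ (contDiffOn_pd (m := 1) hΩ (hF l) (by norm_num) i)
        le_rfl hy
    rw [← pd_sum fun l _ => hd' l x hx]
    refine pd_eq_zero (c := 0) hΩ (fun y hy => ?_) hx i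
    rw [← pd_sum fun l _ => hd l y hy]
    exact pd_eq_zero hΩ h0 hy i
  have h1 := fun i => hcomm i (fun m => pd m (pd m (f k))) (fun m => c2 m m k) hlap
  have h2 := fun i => hcomm i (fun l => pd k (pd l (f l))) (fun l => c2 k l l) hdiv
  have h3 : ∑ l, ∑ i, pd i (pd i (pd k (pd l (f l)))) x = 0 := by
    rw [Finset.sum_comm]
    simp [h2]
  simp [add_mul, Finset.sum_add_distrib, ← Finset.mul_sum, h1, h3]

theorem sum_strain_eq (T : Fin 3 → Fin 3 → ℝ) (hT : ∀ l m, T l m = T m l) (y : Space) :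
    ∑ l, ∑ m, T l m * strain u l m y = ∑ l, ∑ m, T l m * pd m (fun z => u z l) y := by
  have h : ∑ l, ∑ m, T l m * pd l (fun z => u z m) y =
      ∑ l, ∑ m, T l m * pd m (fun z => u z l) y := by
    rw [Finset.sum_comm]
    simp only [fun l m => hT m l]
  simp only [strain, mul_add, Finset.sum_add_distrib, mul_left_comm _ (1 / 2 : ℝ),
    ← Finset.mul_sum, h]
  ring

theorem Material.stress_eq (L : Material) (hM : L.M = 0) (u : Space → Space) (i k : Fin 3) :
    L.stress u i k = fun y => ∑ l, ∑ m, L.C i k l m * pd m (fun z => u z l) y := by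
  ext y
  simp only [Material.stress, hM, Pi.zero_apply, zero_mul, Finset.sum_const_zero, add_zero]
  exact sum_strain_eq (L.C i k) (fun l m => by rw [L.C_major, L.C_minor, L.C_major]) y

theorem pd_strain (hΩ : IsOpen Ω) (hu : ContDiffOn ℝ 2 u Ω) (hx : x ∈ Ω) (l m n : Fin 3) :
    pd n (strain u l m) x = (1 / 2 : ℝ) *
      (pd n (pd m (fun z => u z l)) x + pd n (pd l (fun z => u z m)) x) := by
  have hd : ∀ i j, DifferentiableAt ℝ (pd i (fun z => u z j)) x := fun i j =>
    differentiableAt_of_contDiffOn hΩ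
      (contDiffOn_pd (m := 1) hΩ (contDiffOn_coord hu j) (by norm_num) i) le_rfl hx
  rw [← pd_add (hd _ _) (hd _ _)]
  exact pd_const_mul ((hd _ _).add (hd _ _)) _ _

theorem Material.hyperstress_eq (L : Material) (hM : L.M = 0) (hΩ : IsOpen Ω)
    (hu : ContDiffOn ℝ 2 u Ω) (hx : x ∈ Ω) (i j k : Fin 3) :
    L.hyperstress u i j k x =
      ∑ l, ∑ m, ∑ n, L.A i j k l m n * pd n (pd m (fun z => u z l)) x := by
  simp only [Material.hyperstress, hM, Pi.zero_apply, zero_mul, Finset.sum_const_zero, zero_add,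
    pd_strain hΩ hu hx]
  have hA : ∀ l m n, L.A i j k l m n = L.A i j k m l n := fun l m n => by
    rw [L.A_major, L.A_minor, L.A_major]
  have h : ∑ l, ∑ m, ∑ n, L.A i j k l m n * pd n (pd l (fun z => u z m)) x =
      ∑ l, ∑ m, ∑ n, L.A i j k l m n * pd n (pd m (fun z => u z l)) x := by
    rw [Finset.sum_comm]
    simp only [fun l m n => hA m l n]
  simp only [mul_add, Finset.sum_add_distrib, mul_left_comm _ (1 / 2 : ℝ),
    ← Finset.mul_sum, h]
  ring

theorem Material.pd_stress (L : Material) (hM : L.M = 0) (hΩ : IsOpen Ω)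
    (hu : ContDiffOn ℝ 2 u Ω) (hx : x ∈ Ω) (i k : Fin 3) :
    pd i (L.stress u i k) x =
      ∑ l, ∑ m, L.C i k l m * pd i (pd m (fun z => u z l)) x := by
  have hd : ∀ i j, DifferentiableAt ℝ (pd i (fun z => u z j)) x := fun i j =>
    differentiableAt_of_contDiffOn hΩ
      (contDiffOn_pd (m := 1) hΩ (contDiffOn_coord hu j) (by norm_num) i) le_rfl hx
  rw [L.stress_eq hM, pd_sum fun l _ => by fun_prop (disch := exact hd _ _)]
  refine Finset.sum_congr rfl fun l _ => ?_
  rw [pd_sum fun m _ => (hd _ _).const_mul _]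
  exact Finset.sum_congr rfl fun m _ => pd_const_mul (hd _ _) _ _

theorem pd_sum_three (c : Fin 3 → Fin 3 → Fin 3 → ℝ) {F : Fin 3 → Fin 3 → Fin 3 → Space → ℝ}
    (hF : ∀ l m n, DifferentiableAt ℝ (F l m n) x) (j : Fin 3) :
    pd j (fun y => ∑ l, ∑ m, ∑ n, c l m n * F l m n y) x =
      ∑ l, ∑ m, ∑ n, c l m n * pd j (F l m n) x := by
  have h1 : ∀ l m n, DifferentiableAt ℝ (fun y => c l m n * F l m n y) x := fun l m n =>
    (hF l m n).const_mul _
  have h2 : ∀ l m, DifferentiableAt ℝ (fun y => ∑ n, c l m n * F l m n y) x := fun l m =>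
    DifferentiableAt.fun_sum fun n _ => h1 l m n
  rw [pd_sum fun l _ => DifferentiableAt.fun_sum fun m _ => h2 l m]
  refine Finset.sum_congr rfl fun l _ => ?_
  rw [pd_sum fun m _ => h2 l m]
  refine Finset.sum_congr rfl fun m _ => ?_
  rw [pd_sum fun n _ => h1 l m n]
  exact Finset.sum_congr rfl fun n _ => pd_const_mul (hF l m n) _ _

theorem Material.pd_pd_hyperstress (L : Material) (hM : L.M = 0) (hΩ : IsOpen Ω)
    (hu : ContDiffOn ℝ 4 u Ω) (hx : x ∈ Ω) (i j a b c : Fin 3) :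
    pd i (pd j (L.hyperstress u a b c)) x =
      ∑ l, ∑ m, ∑ n, L.A a b c l m n * pd i (pd j (pd n (pd m (fun z => u z l)))) x := by
  have c2 : ∀ l m n, ContDiffOn ℝ 2 (pd n (pd m (fun z => u z l))) Ω := fun l m n =>
    contDiffOn_pd hΩ (contDiffOn_pd (m := 3) hΩ (contDiffOn_coord hu l) (by norm_num) m)
      (by norm_num) n
  have d2 : ∀ y ∈ Ω, ∀ l m n, DifferentiableAt ℝ (pd n (pd m (fun z => u z l))) y :=
    fun y hy l m n => differentiableAt_of_contDiffOn hΩ (c2 l m n) (by norm_num) hy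
  have d1 : ∀ l m n, DifferentiableAt ℝ (pd j (pd n (pd m (fun z => u z l)))) x :=
    fun l m n => differentiableAt_of_contDiffOn hΩ
      (contDiffOn_pd (m := 1) hΩ (c2 l m n) (by norm_num) j) le_rfl hx
  rw [← pd_sum_three _ d1]
  refine pd_congr hΩ (fun y hy => ?_) hx i
  rw [← pd_sum_three _ (d2 y hy)]
  exact pd_congr hΩ (fun z hz => L.hyperstress_eq hM hΩ (hu.of_le (by norm_num)) hz a b c) hy j

/-- Vanishing Laplacian and vanishing gradient of the divergence, in components. -/
def IsClassicalUniversal (Ω : Set Space) (u : Space → Space) : Prop :=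
  ∀ y ∈ Ω, ∀ k, ∑ i, pd i (pd i (fun z => u z k)) y = 0 ∧ ∑ l, pd k (pd l (fun z => u z l)) y = 0

theorem IsClassicalUniversal.sum_pd_stress (h : IsClassicalUniversal Ω u) {L : Material}
    (hL : L.IsClassO3) (hΩ : IsOpen Ω) (hu : ContDiffOn ℝ 2 u Ω) (hx : x ∈ Ω) (k : Fin 3) :
    ∑ i, pd i (L.stress u i k) x = 0 := by
  obtain ⟨hM, hC, -⟩ := L.isClassO3_iff.mp hL
  obtain ⟨a, b, hab⟩ := exists_isotropic_symbol4 hC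
  simp only [L.pd_stress hM hΩ hu hx]
  rw [Finset.sum_comm]
  exact sum_pd_pd_eq_zero hΩ (G := fun l i j => L.C i k l j) (fun l ξ => hab k l ξ)
    (fun l => contDiffOn_coord hu l) (fun y hy => (h y hy k).1) (fun y hy => (h y hy k).2) hx

theorem IsClassicalUniversal.sum_pd_pd_hyperstress (h : IsClassicalUniversal Ω u) {L : Material}
    (hL : L.IsClassO3) (hΩ : IsOpen Ω) (hu : ContDiffOn ℝ 4 u Ω) (hx : x ∈ Ω) (k : Fin 3) :
    ∑ i, ∑ j, pd i (pd j (L.hyperstress u i k j)) x = 0 ∧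
      ∑ i, ∑ j, pd i (pd j (L.hyperstress u i j k)) x = 0 := by
  obtain ⟨hM, -, hA⟩ := L.isClassO3_iff.mp hL
  -- Brings the displacement index l outermost and exchanges m and n: the strain-gradient slot n is
  -- differentiated outside the slot m.
  have hreorder : ∀ F : Fin 3 → Fin 3 → Fin 3 → Fin 3 → Fin 3 → ℝ,
      ∑ i, ∑ j, ∑ l, ∑ m, ∑ n, F l i j n m = ∑ l, ∑ i, ∑ j, ∑ m, ∑ n, F l i j m n := by
    intro F
    rw [Finset.sum_comm (s := Finset.univ (α := Fin 3)) (t := Finset.univ (α := Fin 3))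
      (f := fun l i => ∑ j, ∑ m, ∑ n, F l i j m n)]
    refine Finset.sum_congr rfl fun i _ => ?_
    rw [Finset.sum_comm]
    refine Finset.sum_congr rfl fun l _ => Finset.sum_congr rfl fun j _ => Finset.sum_comm
  simp only [L.pd_pd_hyperstress hM hΩ hu hx]
  constructor
  · obtain ⟨a, b, hab⟩ := exists_isotropic_symbol6 hA
    rw [hreorder fun l i j n m => L.A i k j l m n * pd i (pd j (pd n (pd m fun z => u z l))) x]
    exact sum_pd_four_eq_zero hΩ (G := fun l i j n m => L.A i k j l m n) (fun l ξ => hab k l ξ)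
      (fun l => contDiffOn_coord hu l) (fun y hy => (h y hy k).1) (fun y hy => (h y hy k).2) hx
  · obtain ⟨a, b, hab⟩ := exists_isotropic_symbol6' hA
    rw [hreorder fun l i j n m => L.A i j k l m n * pd i (pd j (pd n (pd m fun z => u z l))) x]
    exact sum_pd_four_eq_zero hΩ (G := fun l i j n m => L.A i j k l m n) (fun l ξ => hab k l ξ)
      (fun l => contDiffOn_coord hu l) (fun y hy => (h y hy k).1) (fun y hy => (h y hy k).2) hx

theorem IsClassicalUniversal.isUniversalO3 (h : IsClassicalUniversal Ω u) (hΩ : IsOpen Ω)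
    (hu : ContDiffOn ℝ 4 u Ω) : IsUniversalO3 Ω u := by
  intro L hL x hx k
  rw [h.sum_pd_stress hL hΩ (hu.of_le (by norm_num)) hx k,
    (h.sum_pd_pd_hyperstress hL hΩ hu hx k).1, sub_zero]

/-- A purely classical material with elasticity tensor `C`. -/
def classicalMaterial (C : Tensor4) (h₁ : ∀ i j l m, C i j l m = C j i l m)
    (h₂ : ∀ i j l m, C i j l m = C l m i j) : Material where
  C := C
  M := 0
  A := 0
  C_minor := h₁
  C_major := h₂
  M_left := by simp
  M_right := by simp
  A_minor := by simp
  A_major := by simp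

theorem sum_mul_eq_ite_of_orthogonal (Q : Matrix.orthogonalGroup (Fin 3) ℝ) (i j : Fin 3) :
    ∑ o, Q.1 i o * Q.1 j o = if i = j then 1 else 0 := by
  have h : Q.1 * star Q.1 = 1 := (Matrix.mem_orthogonalGroup_iff (Fin 3) ℝ).mp Q.2
  simpa [Matrix.mul_apply, Matrix.one_apply] using congrFun (congrFun h i) j

theorem symmetryGroup6_zero : symmetryGroup6 0 = Set.univ := by
  ext Q
  simp only [symmetryGroup6, Set.mem_ofPred_eq, Set.mem_univ, iff_true]
  ext i j k l m n
  simp [rotate6]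

/-- Each Kronecker delta is invariant because QQᵀ = 1. -/
theorem symmetryGroup4_delta_ij_lm :
    symmetryGroup4 (fun i j l m => (if i = j then 1 else 0) * (if l = m then 1 else 0)) =
      Set.univ := by
  ext Q
  simp only [symmetryGroup4, Set.mem_ofPred_eq, Set.mem_univ, iff_true]
  ext i j l m
  simp only [← sum_mul_eq_ite_of_orthogonal Q i j, ← sum_mul_eq_ite_of_orthogonal Q l m,
    Finset.sum_mul_sum, rotate4]
  simp [mul_assoc]

theorem symmetryGroup4_delta_il_jm_add :
    symmetryGroup4 (fun i j l m => (if i = l then 1 else 0) * (if j = m then 1 else 0) +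
      (if i = m then 1 else 0) * (if j = l then 1 else 0)) = Set.univ := by
  ext Q
  simp only [symmetryGroup4, Set.mem_ofPred_eq, Set.mem_univ, iff_true]
  ext i j l m
  simp only [← sum_mul_eq_ite_of_orthogonal Q i l, ← sum_mul_eq_ite_of_orthogonal Q j m,
    ← sum_mul_eq_ite_of_orthogonal Q i m, ← sum_mul_eq_ite_of_orthogonal Q j l,
    Finset.sum_mul_sum, rotate4, mul_add, Finset.sum_add_distrib]
  simp only [mul_ite, mul_one, mul_zero, Finset.sum_ite_irrel, Finset.sum_ite_eq, Finset.mem_univ,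
    if_true, Finset.sum_const_zero]
  congr 1 <;> exact Finset.sum_congr rfl fun _ _ => Finset.sum_congr rfl fun _ _ => by ring

theorem IsUniversalO3.sum_C_eq_zero (h : IsUniversalO3 Ω u) (hΩ : IsOpen Ω)
    (hu : ContDiffOn ℝ 4 u Ω) {C : Tensor4} (h₁ : ∀ i j l m, C i j l m = C j i l m)
    (h₂ : ∀ i j l m, C i j l m = C l m i j) (hC : symmetryGroup4 C = Set.univ)
    (hx : x ∈ Ω) (k : Fin 3) :
    ∑ i, ∑ l, ∑ m, C i k l m * pd i (pd m (fun z => u z l)) x = 0 := by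
  have hL := h (classicalMaterial C h₁ h₂)
    ((Material.isClassO3_iff _).mpr ⟨rfl, hC, symmetryGroup6_zero⟩) x hx k
  simp only [(classicalMaterial C h₁ h₂).pd_stress rfl hΩ (hu.of_le (by norm_num)) hx,
    (classicalMaterial C h₁ h₂).pd_pd_hyperstress rfl hΩ hu hx] at hL
  simpa [classicalMaterial] using hL

/-- Two test materials with `M = 0` and `A = 0`: δ_{ij}δ_{lm} yields ∂_k div u = 0, and δ_{il}δ_{jm}
+ δ_{im}δ_{jl} yields Δu_k + ∂_k div u = 0. -/
theorem IsUniversalO3.isClassicalUniversal (h : IsUniversalO3 Ω u) (hΩ : IsOpen Ω)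
    (hu : ContDiffOn ℝ 4 u Ω) : IsClassicalUniversal Ω u := by
  intro x hx k
  have h1 := h.sum_C_eq_zero hΩ hu (C := fun i j l m => (if i = j then 1 else 0) *
    (if l = m then 1 else 0)) (by intros; simp [eq_comm]) (by intros; exact mul_comm _ _)
    symmetryGroup4_delta_ij_lm hx k
  have h2 := h.sum_C_eq_zero hΩ hu (C := fun i j l m => (if i = l then 1 else 0) *
    (if j = m then 1 else 0) + (if i = m then 1 else 0) * (if j = l then 1 else 0))
    (by intros; ring) (by intro i j l m; simp only [eq_comm (a := i), eq_comm (a := j)]; ring)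
    symmetryGroup4_delta_il_jm_add hx k
  simp [Finset.sum_ite_irrel] at h1
  simp [add_mul, Finset.sum_add_distrib] at h2
  have h3 : ∀ i, pd i (pd k fun z => u z i) x = pd k (pd i fun z => u z i) x := fun i =>
    pd_comm (((contDiffOn_coord hu i).of_le (by norm_num)).contDiffAt (hΩ.mem_nhds hx)) _ _
  simp only [h3, h1, zero_add] at h2
  exact ⟨h2, h1⟩

theorem isClassicalUniversal_iff (hΩ : IsOpen Ω) (hu : ContDiffOn ℝ 4 u Ω) :
    IsClassicalUniversal Ω u ↔ (∀ x ∈ Ω, Laplacian.laplacian u x = 0) ∧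
      ∀ x ∈ Ω, gradient (divergence u) x = 0 := by
  have hd : ∀ x ∈ Ω, ∀ i, DifferentiableAt ℝ (pd i (fun z => u z i)) x := fun x hx i =>
    differentiableAt_of_contDiffOn hΩ
      (contDiffOn_pd (m := 3) hΩ (contDiffOn_coord hu i) (by norm_num) i) (by norm_num) hx
  have h1 : ∀ x ∈ Ω, (Laplacian.laplacian u x = 0 ↔
      ∀ k, ∑ i, pd i (pd i (fun z => u z k)) x = 0) := fun x hx =>
    laplacian_eq_zero_iff ((hu.of_le (by norm_num)).contDiffAt (hΩ.mem_nhds hx))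
  have h2 : ∀ x ∈ Ω, (gradient (divergence u) x = 0 ↔
      ∀ k, ∑ l, pd k (pd l (fun z => u z l)) x = 0) := by
    intro x hx
    rw [gradient_eq_zero_iff_pd]
    refine forall_congr' fun k => ?_
    unfold divergence
    rw [pd_sum fun i _ => hd x hx i]
  constructor
  · intro h
    exact ⟨fun x hx => (h1 x hx).mpr fun k => (h x hx k).1,
      fun x hx => (h2 x hx).mpr fun k => (h x hx k).2⟩
  · intro h x hx k
    exact ⟨(h1 x hx).mp (h.1 x hx) k, (h2 x hx).mp (h.2 x hx) k⟩

theorem isUniversalO3_iff (hΩ : IsOpen Ω) (hu : ContDiffOn ℝ 4 u Ω) :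
    IsUniversalO3 Ω u ↔ IsClassicalUniversal Ω u :=
  ⟨fun h => h.isClassicalUniversal hΩ hu, fun h => h.isUniversalO3 hΩ hu⟩

theorem laplacian_eq_zero_of_eqOn_zero (hΩ : IsOpen Ω) {v : Space → Space}
    (h : ∀ y ∈ Ω, v y = 0) (hx : x ∈ Ω) : Laplacian.laplacian v x = 0 := by
  have h0 : v =ᶠ[nhds x] fun _ => 0 := Filter.eventually_of_mem (hΩ.mem_nhds hx) h
  rw [InnerProductSpace.laplacian_congr_nhds h0 |>.self_of_nhds]
  simp

end Equilibrium

/-! ### Weighted averages along segments and their regularity. -/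

section RadialAverage

open MeasureTheory

variable {F : Type*} [NormedAddCommGroup F] [NormedSpace ℝ F] {V : Set Space} {p x : Space}
  {w : Space → F}

/-- The weighted average `∫₀¹ tˢ w(p + t (x - p)) dt` of a field along the segment from `p`
to `x`. -/
noncomputable def radialAverage (p : Space) (s : ℕ) (w : Space → F) (x : Space) : F :=
  ∫ t in (0 : ℝ)..1, t ^ s • w (p + t • (x - p))

theorem continuousOn_radial (hV : StarConvex ℝ p V) (hw : ContinuousOn w V) (hx : x ∈ V) (s : ℕ) :
    ContinuousOn (fun t : ℝ => t ^ s • w (p + t • (x - p))) (Set.uIcc 0 1) := by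
  rw [Set.uIcc_of_le zero_le_one]
  refine (by fun_prop : ContinuousOn (fun t : ℝ => t ^ s) (Set.Icc 0 1)).smul
    (hw.comp (by fun_prop) fun t ht => hV.add_smul_sub_mem hx ht.1 ht.2)

theorem intervalIntegrable_radial (hV : StarConvex ℝ p V) (hw : ContinuousOn w V) (hx : x ∈ V)
    (s : ℕ) : IntervalIntegrable (fun t : ℝ => t ^ s • w (p + t • (x - p))) volume 0 1 :=
  (continuousOn_radial hV hw hx s).intervalIntegrable

/-- The segment is compact, so a closed thickening of it stays in `V` and `w` is bounded there. This
supplies the constant dominating function for the integrals below. -/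
theorem exists_bound_near_segment {G : Type*} [NormedAddCommGroup G] {w : Space → G}
    (hVo : IsOpen V) (hV : StarConvex ℝ p V) (hw : ContinuousOn w V)
    (hx : x ∈ V) : ∃ δ > 0, ∃ C, ∀ y ∈ Metric.ball x δ, y ∈ V ∧
      ∀ t ∈ Set.Icc (0 : ℝ) 1, ‖w (p + t • (y - p))‖ ≤ C := by
  have hK : IsCompact ((fun t : ℝ => p + t • (x - p)) '' Set.Icc 0 1) :=
    isCompact_Icc.image (by fun_prop)
  obtain ⟨δ, hδ, hsub⟩ := hK.exists_cthickening_subset_open hVo (by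
    rintro _ ⟨t, ht, rfl⟩
    exact hV.add_smul_sub_mem hx ht.1 ht.2)
  obtain ⟨C, hC⟩ := hK.cthickening.exists_bound_of_continuousOn (hw.mono hsub)
  have hmem : ∀ y ∈ Metric.ball x δ, ∀ t ∈ Set.Icc (0 : ℝ) 1, p + t • (y - p) ∈
      Metric.cthickening δ ((fun t : ℝ => p + t • (x - p)) '' Set.Icc 0 1) := by
    intro y hy t ht
    refine Metric.mem_cthickening_of_dist_le _ _ _ _ ⟨t, ht, rfl⟩ ?_
    rw [dist_add_left, dist_eq_norm, ← smul_sub, sub_sub_sub_cancel_right, norm_smul,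
      Real.norm_eq_abs, abs_of_nonneg ht.1, ← dist_eq_norm]
    exact (mul_le_of_le_one_left dist_nonneg ht.2).trans (Metric.mem_ball.mp hy).le
  refine ⟨δ, hδ, C, fun y hy => ⟨?_, fun t ht => hC _ (hmem y hy t ht)⟩⟩
  have := hsub (hmem y hy 1 ⟨zero_le_one, le_rfl⟩)
  simpa using this

theorem norm_pow_smul_le {t : ℝ} (ht : t ∈ Set.Icc (0 : ℝ) 1) (s : ℕ) {a : F} {C : ℝ}
    (ha : ‖a‖ ≤ C) : ‖t ^ s • a‖ ≤ C := by
  rw [norm_smul, norm_pow, Real.norm_eq_abs, abs_of_nonneg ht.1]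
  exact (mul_le_of_le_one_left (norm_nonneg _) (pow_le_one₀ ht.1 ht.2)).trans ha

theorem continuousOn_radialAverage (hVo : IsOpen V) (hV : StarConvex ℝ p V)
    (hw : ContinuousOn w V) (s : ℕ) : ContinuousOn (radialAverage p s w) V := by
  intro x hx
  refine ContinuousAt.continuousWithinAt ?_
  obtain ⟨δ, hδ, C, hC⟩ := exists_bound_near_segment hVo hV hw hx
  have hI : Set.uIoc (0 : ℝ) 1 ⊆ Set.Icc 0 1 := by
    rw [Set.uIoc_of_le zero_le_one]
    exact Set.Ioc_subset_Icc_self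
  refine intervalIntegral.continuousAt_of_dominated_interval (bound := fun _ => C) ?_ ?_
    intervalIntegrable_const ?_
  · filter_upwards [Metric.ball_mem_nhds x hδ] with y hy
    exact (intervalIntegrable_radial hV hw (hC y hy).1 s).def'.aestronglyMeasurable
  · filter_upwards [Metric.ball_mem_nhds x hδ] with y hy
    exact Filter.Eventually.of_forall fun t ht => norm_pow_smul_le (hI ht) s
      ((hC y hy).2 t (hI ht))
  · refine Filter.Eventually.of_forall fun t ht => ?_
    have hm := hV.add_smul_sub_mem hx (hI ht).1 (hI ht).2
    refine ContinuousAt.const_smul ?_ (t ^ s)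
    exact ContinuousAt.comp (f := fun y => p + t • (y - p)) (g := w)
      (hw.continuousAt (hVo.mem_nhds hm)) (by fun_prop)

/-- Differentiation under the integral; the chain rule contributes one factor t, which raises the
weight. -/
theorem hasFDerivAt_radialAverage (hVo : IsOpen V) (hV : StarConvex ℝ p V)
    (hw : ContDiffOn ℝ 1 w V) (hx : x ∈ V) (s : ℕ) :
    HasFDerivAt (radialAverage p s w) (radialAverage p (s + 1) (fderiv ℝ w) x) x := by
  have hw' : ContinuousOn (fderiv ℝ w) V := hw.continuousOn_fderiv_of_isOpen hVo le_rfl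
  obtain ⟨δ, hδ, C, hC⟩ := exists_bound_near_segment hVo hV hw' hx
  have hI : Set.uIoc (0 : ℝ) 1 ⊆ Set.Icc 0 1 := by
    rw [Set.uIoc_of_le zero_le_one]
    exact Set.Ioc_subset_Icc_self
  refine intervalIntegral.hasFDerivAt_integral_of_dominated_of_fderiv_le
    (F' := fun y t => t ^ (s + 1) • fderiv ℝ w (p + t • (y - p)))
    (bound := fun _ => C) (Metric.ball_mem_nhds x hδ) ?_
    (intervalIntegrable_radial hV hw.continuousOn hx s)
    (intervalIntegrable_radial hV hw' hx (s + 1)).def'.aestronglyMeasurable ?_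
    intervalIntegrable_const ?_
  · filter_upwards [Metric.ball_mem_nhds x hδ] with y hy
    exact (intervalIntegrable_radial hV hw.continuousOn (hC y hy).1 s).def'.aestronglyMeasurable
  · exact Filter.Eventually.of_forall fun t ht y hy => norm_pow_smul_le (hI ht) (s + 1)
      ((hC y hy).2 t (hI ht))
  · refine Filter.Eventually.of_forall fun t ht y hy => ?_
    have hm := hV.add_smul_sub_mem (hC y hy).1 (hI ht).1 (hI ht).2
    have hd : HasFDerivAt w (fderiv ℝ w (p + t • (y - p))) (p + t • (y - p)) :=
      ((hw.contDiffAt (hVo.mem_nhds hm)).differentiableAt (by norm_num)).hasFDerivAt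
    have hl : HasFDerivAt (fun y => p + t • (y - p)) (t • ContinuousLinearMap.id ℝ Space) y :=
      (((hasFDerivAt_id y).sub_const p).const_smul t).const_add p
    have h := (hd.comp y hl).const_smul (t ^ s)
    refine h.congr_fderiv ?_
    ext v
    simp [pow_succ, mul_smul]

/-- The target space and the weight vary in the induction, because the derivative of an average is
an average of `fderiv ℝ w` with weight s + 1. -/
theorem contDiffOn_radialAverage_nat (hVo : IsOpen V) (hV : StarConvex ℝ p V) (n : ℕ) :
    ∀ {F : Type*} [NormedAddCommGroup F] [NormedSpace ℝ F] {w : Space → F} (s : ℕ),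
      ContDiffOn ℝ n w V → ContDiffOn ℝ n (radialAverage p s w) V := by
  induction n with
  | zero =>
    intro F _ _ w s hw
    simp only [Nat.cast_zero, contDiffOn_zero] at hw ⊢
    exact continuousOn_radialAverage hVo hV hw s
  | succ n ih =>
    intro F _ _ w s hw
    have h1 : ContDiffOn ℝ 1 w V := hw.of_le (by exact_mod_cast Nat.le_add_left 1 n)
    push_cast at hw ⊢
    rw [contDiffOn_succ_iff_fderiv_of_isOpen hVo] at hw ⊢
    refine ⟨fun x hx => (hasFDerivAt_radialAverage hVo hV h1 hx s).differentiableAt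
      |>.differentiableWithinAt, by simp, ?_⟩
    exact (ih (s + 1) hw.2.2).congr fun x hx => (hasFDerivAt_radialAverage hVo hV h1 hx s).fderiv

theorem contDiffOn_radialAverage (hVo : IsOpen V) (hV : StarConvex ℝ p V) {n : ℕ∞} (s : ℕ)
    (hw : ContDiffOn ℝ n w V) : ContDiffOn ℝ n (radialAverage p s w) V :=
  contDiffOn_iff_forall_nat_le.mpr fun m hm =>
    contDiffOn_radialAverage_nat hVo hV m s (hw.of_le (by exact_mod_cast hm))

/-- The combined integrand is d/dt of t^(s+1) w(p + t(x - p)), whose boundary term at 0 vanishes. -/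
theorem radialAverage_euler [CompleteSpace F] (hVo : IsOpen V) (hV : StarConvex ℝ p V)
    (hw : ContDiffOn ℝ 1 w V) (hx : x ∈ V) (s : ℕ) :
    ((s : ℝ) + 1) • radialAverage p s w x + fderiv ℝ (radialAverage p s w) x (x - p) = w x := by
  have hw' : ContinuousOn (fderiv ℝ w) V := hw.continuousOn_fderiv_of_isOpen hVo le_rfl
  have hi1 := intervalIntegrable_radial hV hw.continuousOn hx s
  have hi2 := intervalIntegrable_radial hV hw' hx (s + 1)
  have hi1' : IntervalIntegrable (fun t : ℝ => ((s : ℝ) + 1) • t ^ s • w (p + t • (x - p)))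
      volume 0 1 := hi1.smul _
  have hi2' : IntervalIntegrable (fun t : ℝ => (t ^ (s + 1) • fderiv ℝ w (p + t • (x - p))) (x - p))
      volume 0 1 :=
    ((continuousOn_radial hV hw' hx (s + 1)).clm_apply continuousOn_const).intervalIntegrable
  rw [(hasFDerivAt_radialAverage hVo hV hw hx s).fderiv, radialAverage, radialAverage,
    ContinuousLinearMap.intervalIntegral_apply hi2, ← intervalIntegral.integral_smul,
    ← intervalIntegral.integral_add hi1' hi2']
  have hderiv : ∀ t ∈ Set.uIcc (0 : ℝ) 1,
      HasDerivAt (fun t : ℝ => t ^ (s + 1) • w (p + t • (x - p)))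
        (((s : ℝ) + 1) • t ^ s • w (p + t • (x - p)) +
          (t ^ (s + 1) • fderiv ℝ w (p + t • (x - p))) (x - p)) t := by
    intro t ht
    rw [Set.uIcc_of_le zero_le_one] at ht
    have hm := hV.add_smul_sub_mem hx ht.1 ht.2
    have hd : HasFDerivAt w (fderiv ℝ w (p + t • (x - p))) (p + t • (x - p)) :=
      ((hw.contDiffAt (hVo.mem_nhds hm)).differentiableAt (by norm_num)).hasFDerivAt
    have hl : HasDerivAt (fun t : ℝ => p + t • (x - p)) (x - p) t := by
      simpa using ((hasDerivAt_id t).smul_const (x - p)).const_add p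
    have h := (hasDerivAt_pow (s + 1) t).smul (hd.comp_hasDerivAt t hl)
    refine h.congr_deriv ?_
    simp [smul_smul, add_comm]
  rw [intervalIntegral.integral_eq_sub_of_hasDerivAt hderiv (hi1'.add hi2')]
  simp

end RadialAverage

/-! ### The Poincaré lemma for divergence-free fields. -/

section Potential

variable {V : Set Space} {p x : Space}

theorem pd_radialAverage (hVo : IsOpen V) (hV : StarConvex ℝ p V) {f : Space → ℝ}
    (hf : ContDiffOn ℝ 1 f V) (hx : x ∈ V) (s : ℕ) (j : Fin 3) :
    pd j (radialAverage p s f) x = radialAverage p (s + 1) (pd j f) x := by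
  have hf' : ContinuousOn (fderiv ℝ f) V := hf.continuousOn_fderiv_of_isOpen hVo le_rfl
  rw [pd, (hasFDerivAt_radialAverage hVo hV hf hx s).fderiv, radialAverage,
    ContinuousLinearMap.intervalIntegral_apply (intervalIntegrable_radial hV hf' hx (s + 1))]
  rfl

/-- Poincaré's lemma for divergence-free vector fields on a star-shaped open set. -/
theorem exists_antisymmetric_potential (hVo : IsOpen V) (hV : StarConvex ℝ p V) {n : ℕ∞}
    (hn : 1 ≤ n) {w : Fin 3 → Space → ℝ} (hw : ∀ i, ContDiffOn ℝ n (w i) V)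
    (hdiv : ∀ y ∈ V, ∑ i, pd i (w i) y = 0) :
    ∃ Φ : Fin 3 → Fin 3 → Space → ℝ, (∀ i j, ContDiffOn ℝ n (Φ i j) V) ∧
      (∀ i j x, Φ i j x = -Φ j i x) ∧ ∀ x ∈ V, ∀ i, ∑ j, pd j (Φ i j) x = w i x := by
  have hw1 : ∀ i, ContDiffOn ℝ 1 (w i) V := fun i => (hw i).of_le (by exact_mod_cast hn)
  have hK : ∀ i, ContDiffOn ℝ n (radialAverage p 1 (w i)) V := fun i =>
    contDiffOn_radialAverage hVo hV 1 (hw i)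
  have hl : ∀ j : Fin 3, ContDiff ℝ n fun y : Space => y j - p j := fun j =>
    (EuclideanSpace.proj j : Space →L[ℝ] ℝ).contDiff.sub contDiff_const
  have hpl : ∀ i j x, pd i (fun y : Space => y j - p j) x = if i = j then 1 else 0 := by
    intro i j x
    rw [pd_sub (f := fun y : Space => y j) (g := fun _ => p j)
      (EuclideanSpace.proj j : Space →L[ℝ] ℝ).differentiableAt (differentiableAt_const _), pd_coord]
    simp [pd]
  -- Let K be the average of w with weight t. Then Φ_{ij,j} = 3K_i + (x - p)·∇K_i - K_i - (x_i -
  -- p_i) div K. As div K = 0, this is 2K_i + (x - p)·∇K_i, which is w_i by the Euler identity with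
  -- s = 1. This fixes the weight.
  refine ⟨fun i j y => (y j - p j) * radialAverage p 1 (w i) y -
    (y i - p i) * radialAverage p 1 (w j) y, fun i j => ?_, fun i j y => by ring,
    fun x hx i => ?_⟩
  · exact ((hl j).contDiffOn.mul (hK i)).sub ((hl i).contDiffOn.mul (hK j))
  have hdK : ∀ i, DifferentiableAt ℝ (radialAverage p 1 (w i)) x := fun i =>
    (hasFDerivAt_radialAverage hVo hV (hw1 i) hx 1).differentiableAt
  have hdl : ∀ j : Fin 3, DifferentiableAt ℝ (fun y : Space => y j - p j) x := fun j =>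
    ((hl j).of_le (by exact_mod_cast hn) : ContDiff ℝ 1 _).differentiable (by norm_num) x
  have hpd : ∀ j, pd j (fun y => (y j - p j) * radialAverage p 1 (w i) y -
      (y i - p i) * radialAverage p 1 (w j) y) x =
      radialAverage p 1 (w i) x + (x j - p j) * pd j (radialAverage p 1 (w i)) x -
      ((if j = i then 1 else 0) * radialAverage p 1 (w j) x +
        (x i - p i) * pd j (radialAverage p 1 (w j)) x) := by
    intro j
    rw [pd_sub ((hdl j).fun_mul (hdK i)) ((hdl i).fun_mul (hdK j)), pd_mul (hdl j) (hdK i),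
      pd_mul (hdl i) (hdK j), hpl, hpl]
    simp
    ring
  -- div K is the average of div w with weight t².
  have hdivK : ∑ j, pd j (radialAverage p 1 (w j)) x = 0 := by
    simp only [fun j => pd_radialAverage hVo hV (hw1 j) hx 1 j, radialAverage]
    rw [← intervalIntegral.integral_finsetSum fun j _ => intervalIntegrable_radial hV
      (contDiffOn_pd (m := 0) hVo (hw1 j) (by norm_num) j).continuousOn hx 2]
    rw [intervalIntegral.integral_congr (g := fun _ => (0 : ℝ))]
    · simp
    · intro t ht
      rw [Set.uIcc_of_le zero_le_one] at ht
      simp only [← Finset.smul_sum, hdiv _ (hV.add_smul_sub_mem hx ht.1 ht.2), smul_zero]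
  have heuler := radialAverage_euler hVo hV (hw1 i) hx 1
  rw [fderiv_apply_eq_sum_pd] at heuler
  simp only [hpd, Finset.sum_sub_distrib, Finset.sum_add_distrib, ← Finset.mul_sum, hdivK]
  simp only [PiLp.sub_apply, Nat.cast_one, smul_eq_mul] at heuler
  simp
  linarith

end Potential

/-! ### From potentials to universal fields and back. -/

section Representation

variable {Ω V : Set Space} {u : Space → Space} {x : Space}

/-- Divergence and Laplacian commute, at the cost of three derivatives. This is where the class C³
of the potential is used in full. -/
theorem sum_pd_laplacian (hΩ : IsOpen Ω) {Φ : Fin 3 → Space → ℝ}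
    (hΦ : ∀ j, ContDiffOn ℝ 3 (Φ j) Ω) (hx : x ∈ Ω) :
    ∑ j, pd j (Laplacian.laplacian (Φ j)) x = ∑ m, pd m (pd m fun y => ∑ j, pd j (Φ j) y) x := by
  have c2 : ∀ i j, ContDiffOn ℝ 2 (pd i (Φ j)) Ω := fun i j =>
    contDiffOn_pd hΩ (hΦ j) (by norm_num) i
  have c1 : ∀ m i j, ContDiffOn ℝ 1 (pd m (pd i (Φ j))) Ω := fun m i j =>
    contDiffOn_pd hΩ (c2 i j) (by norm_num) m
  have d2 : ∀ y ∈ Ω, ∀ i j, DifferentiableAt ℝ (pd i (Φ j)) y := fun y hy i j =>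
    differentiableAt_of_contDiffOn hΩ (c2 i j) (by norm_num) hy
  have d1 : ∀ m i j, DifferentiableAt ℝ (pd m (pd i (Φ j))) x := fun m i j =>
    differentiableAt_of_contDiffOn hΩ (c1 m i j) le_rfl hx
  have hl : ∀ j, pd j (Laplacian.laplacian (Φ j)) x = ∑ m, pd m (pd m (pd j (Φ j))) x := by
    intro j
    rw [pd_congr (g := fun y => ∑ m, pd m (pd m (Φ j)) y) hΩ (fun y hy => laplacian_eq_sum_pd
      (((hΦ j).of_le (by norm_num)).contDiffAt (hΩ.mem_nhds hy))) hx, pd_sum fun m _ => d1 m m j]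
    refine Finset.sum_congr rfl fun m _ => ?_
    rw [pd_comm ((c2 m j).contDiffAt (hΩ.mem_nhds hx))]
    exact pd_congr hΩ (fun y hy => pd_comm
      (((hΦ j).of_le (by norm_num)).contDiffAt (hΩ.mem_nhds hy)) _ _) hx m
  simp only [hl]
  rw [Finset.sum_comm]
  refine Finset.sum_congr rfl fun m _ => ?_
  rw [← pd_sum fun j _ => d1 m j j]
  refine (pd_congr hΩ (fun y hy => ?_) hx m).symm
  exact pd_sum (fun j _ => d2 y hy j j) m

theorem pd_affine (F : Fin 3 → ℝ) (c : ℝ) (m : Fin 3) (x : Space) :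
    pd m (fun y => (∑ j, F j * y j) + c) x = F m := by
  have hc : ∀ j, DifferentiableAt ℝ (fun y : Space => y j) x := fun j =>
    (EuclideanSpace.proj j : Space →L[ℝ] ℝ).differentiableAt
  have hs : ∀ j, DifferentiableAt ℝ (fun y : Space => F j * y j) x := fun j => (hc j).const_mul _
  rw [pd_add (DifferentiableAt.fun_sum fun j _ => hs j) (differentiableAt_const _),
    pd_sum fun j _ => hs j]
  simp only [pd_const_mul (hc _), pd_coord]
  simp [pd]

theorem differentiable_affine (F : Fin 3 → ℝ) (c : ℝ) :
    Differentiable ℝ fun y : Space => (∑ j, F j * y j) + c := by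
  fun_prop

theorem HasPotential.isClassicalUniversal {F : Matrix (Fin 3) (Fin 3) ℝ}
    (h : HasPotential 3 Ω F u) (hΩ : IsOpen Ω) (hu : ContDiffOn ℝ 2 u Ω) :
    IsClassicalUniversal Ω u := by
  obtain ⟨k, Φ, S, hΦ, hanti, -, hlap, hS, hrep⟩ := h
  have hΦ3 : ∀ i j, ContDiffOn ℝ 3 (Φ i j) Ω := hΦ
  have c2 : ∀ m i j, ContDiffOn ℝ 2 (pd m (Φ i j)) Ω := fun m i j =>
    contDiffOn_pd hΩ (hΦ3 i j) (by norm_num) m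
  have d2 : ∀ y ∈ Ω, ∀ m i j, DifferentiableAt ℝ (pd m (Φ i j)) y := fun y hy m i j =>
    differentiableAt_of_contDiffOn hΩ (c2 m i j) (by norm_num) hy
  have cs : ∀ i, ContDiffOn ℝ 2 (fun y => ∑ j, pd j (Φ i j) y) Ω := fun i =>
    ContDiffOn.sum fun j _ => c2 j i j
  have hpd : ∀ y ∈ Ω, ∀ m i, pd m (fun z => u z i) y =
      F i m + pd m (fun z => ∑ j, pd j (Φ i j) z) y := by
    intro y hy m i
    rw [pd_congr hΩ (fun z hz => hrep z hz i) hy, pd_add (differentiable_affine _ _ y)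
      (differentiableAt_of_contDiffOn hΩ (cs i) (by norm_num) hy), pd_affine]
  have hdiv : ∀ y ∈ Ω, ∑ l, pd l (fun z => u z l) y = F.trace := by
    intro y hy
    -- A symmetric pair of derivatives meets an antisymmetric matrix: the sum equals its own
    -- negative.
    have h0 : ∑ l, ∑ j, pd l (pd j (Φ l j)) y = -∑ l, ∑ j, pd l (pd j (Φ l j)) y := by
      conv_lhs => rw [Finset.sum_comm]
      rw [← Finset.sum_neg_distrib]
      refine Finset.sum_congr rfl fun l _ => ?_
      rw [← Finset.sum_neg_distrib]
      refine Finset.sum_congr rfl fun j _ => ?_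
      rw [pd_comm (((hΦ3 j l).of_le (by norm_num)).contDiffAt (hΩ.mem_nhds hy)), ← pd_neg]
      refine pd_congr hΩ (fun z hz => ?_) hy l
      rw [← pd_neg]
      exact pd_congr hΩ (fun v hv => hanti j l v hv) hz j
    simp only [hpd y hy, Finset.sum_add_distrib, pd_sum fun j _ => d2 y hy j _ j]
    rw [show ∑ l, ∑ j, pd l (pd j (Φ l j)) y = 0 by linarith, add_zero]
    rfl
  intro y hy k'
  constructor
  · have h1 : ∀ i, pd i (pd i fun z => u z k') y =
        pd i (pd i fun z => ∑ j, pd j (Φ k' j) z) y := by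
      intro i
      rw [pd_congr hΩ (fun z hz => hpd z hz i k') hy, pd_add (differentiableAt_const _)
        (differentiableAt_of_contDiffOn hΩ (contDiffOn_pd (m := 1) hΩ (cs k') (by norm_num) i)
          le_rfl hy), pd_eq_zero hΩ (fun _ _ => rfl) hy, zero_add]
    simp only [h1]
    rw [← sum_pd_laplacian hΩ (hΦ3 k') hy, ← hS k' y hy]
    exact Finset.sum_congr rfl fun j _ => pd_congr hΩ (hlap k' j) hy j
  · rw [← pd_sum fun l _ => differentiableAt_of_contDiffOn hΩ
      (contDiffOn_pd (m := 1) hΩ (contDiffOn_coord hu l) (by norm_num) l) le_rfl hy]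
    exact pd_eq_zero hΩ hdiv hy k'

theorem HasPotential.of_le {m n : ℕ∞} (hmn : m ≤ n) {F : Matrix (Fin 3) (Fin 3) ℝ}
    (h : HasPotential n V F u) : HasPotential m V F u := by
  obtain ⟨k, Φ, S, hΦ, h⟩ := h
  exact ⟨k, Φ, S, fun i j => (hΦ i j).of_le (by exact_mod_cast hmn), h⟩

theorem IsClassicalUniversal.mono (h : IsClassicalUniversal Ω u) (hV : V ⊆ Ω) :
    IsClassicalUniversal V u := fun y hy => h y (hV hy)

/-- A star-shaped set is connected, so div u is a constant c. In dimension 3 the field (c/3)x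
carries this divergence, and the remainder is divergence-free. The sources are defined as the
Laplacians of its potential. -/
theorem IsClassicalUniversal.exists_hasPotential (h : IsClassicalUniversal V u) (hVo : IsOpen V)
    {p : Space} (hV : StarConvex ℝ p V) {n : ℕ∞} (hn : 4 ≤ n) (hu : ContDiffOn ℝ n u V) :
    ∃ c : ℝ, HasPotential n V ((c / 3) • 1) u := by
  have hu4 : ContDiffOn ℝ 4 u V := hu.of_le (WithTop.coe_le_coe.mpr hn)
  have c3 : ∀ i k, ContDiffOn ℝ 3 (pd i fun z => u z k) V := fun i k =>
    contDiffOn_pd hVo (contDiffOn_coord hu4 k) (by norm_num) i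
  have d3 : ∀ y ∈ V, ∀ i k, DifferentiableAt ℝ (pd i fun z => u z k) y := fun y hy i k =>
    differentiableAt_of_contDiffOn hVo (c3 i k) (by norm_num) hy
  have hconn : IsPreconnected V := by
    rcases V.eq_empty_or_nonempty with rfl | hne
    · exact isPreconnected_empty
    · exact (hV.isPathConnected (hV.mem hne)).isConnected.isPreconnected
  obtain ⟨c, hc⟩ := hVo.exists_is_const_of_fderiv_eq_zero (𝕜 := ℝ) hconn
    (f := fun y => ∑ l, pd l (fun z => u z l) y)
    (fun y hy => (DifferentiableAt.fun_sum fun l _ => d3 y hy l l).differentiableWithinAt)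
    (fun y hy => fderiv_eq_zero_iff_pd.mpr fun k => by
      rw [pd_sum fun l _ => d3 y hy l l, (h y hy k).2])
  have hcoord : ∀ i, ContDiff ℝ n fun y : Space => c / 3 * y i := fun i =>
    contDiff_const.mul (EuclideanSpace.proj i : Space →L[ℝ] ℝ).contDiff
  have dcoord : ∀ i (y : Space), DifferentiableAt ℝ (fun y : Space => y i) y := fun i y =>
    (EuclideanSpace.proj i : Space →L[ℝ] ℝ).differentiableAt
  have dcoord' : ∀ i (y : Space), DifferentiableAt ℝ (fun y : Space => c / 3 * y i) y := fun i y =>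
    (dcoord i y).const_mul _
  have hpw : ∀ y ∈ V, ∀ m i, pd m (fun z => u z i - c / 3 * z i) y =
      pd m (fun z => u z i) y - c / 3 * if m = i then 1 else 0 := by
    intro y hy m i
    rw [pd_sub (differentiableAt_of_contDiffOn hVo (contDiffOn_coord hu4 i) (by norm_num) hy)
      (dcoord' i y), pd_const_mul (dcoord i y), pd_coord]
  obtain ⟨Φ, hΦ, hanti, hrep⟩ := exists_antisymmetric_potential (n := n) hVo hV
    (le_trans (by norm_num) hn) (w := fun i y => u y i - c / 3 * y i)
    (fun i => (contDiffOn_coord hu i).sub (hcoord i).contDiffOn)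
    (fun y hy => by
      simp only [hpw y hy, Finset.sum_sub_distrib, hc y hy]
      simp
      ring)
  have hΦ3 : ∀ i j, ContDiffOn ℝ 3 (Φ i j) V := fun i j =>
    (hΦ i j).of_le (WithTop.coe_le_coe.mpr (le_trans (by norm_num : (3 : ℕ∞) ≤ 4) hn))
  refine ⟨c, 0, Φ, fun i j => Laplacian.laplacian (Φ i j), hΦ, fun i j y _ => hanti i j y,
    fun i j y _ => ?_, fun _ _ _ _ => rfl, fun i y hy => ?_, fun y hy i => ?_⟩
  · change Laplacian.laplacian (Φ i j) y = -Laplacian.laplacian (Φ j i) y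
    have hneg : Φ i j = -Φ j i := funext fun z => hanti i j z
    rw [hneg, InnerProductSpace.laplacian_neg]
    rfl
  -- The sources are divergence-free because Φ_{ij,j} differs from u_i by a linear field, and u is
  -- harmonic.
  · rw [sum_pd_laplacian hVo (hΦ3 i) hy, ← (h y hy i).1]
    refine Finset.sum_congr rfl fun m _ => ?_
    rw [pd_congr hVo (fun z hz => (pd_congr hVo (fun v hv => hrep v hv i) hz m).trans
      (hpw z hz m i)) hy, pd_sub (d3 y hy m i) (differentiableAt_const _),
      pd_eq_zero (f := fun _ => c / 3 * if m = i then 1 else 0) hVo (fun _ _ => rfl) hy, sub_zero]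
  · rw [hrep y hy i]
    simp [Matrix.one_apply]

end Representation

end StrainGradient

/-! ### The main theorem. -/

theorem mainTheorem1 :
    -- the class `O(3)`: the coupling tensor vanishes, and the two other tensors are isotropic
    (∀ L : StrainGradient.Material, L.IsClassO3 ↔
      L.M = 0 ∧ StrainGradient.symmetryGroup4 L.C = Set.univ ∧
        StrainGradient.symmetryGroup6 L.A = Set.univ) ∧
    ∀ (n : ℕ∞) (_hn : 4 ≤ n) (Ω : Set StrainGradient.Space) (_hΩ : IsOpen Ω)
      (u : StrainGradient.Space → StrainGradient.Space) (_hu : ContDiffOn ℝ n u Ω),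
      -- universality is equivalent to the classical isotropic constraints
      (StrainGradient.IsUniversalO3 Ω u ↔
        (∀ x ∈ Ω, Laplacian.laplacian u x = 0) ∧
        (∀ x ∈ Ω, gradient (StrainGradient.divergence u) x = 0)) ∧
      -- representation in a star-shaped body
      ((∃ p, StarConvex ℝ p Ω) →
        (StrainGradient.IsUniversalO3 Ω u ↔
          ∃ c : ℝ, StrainGradient.HasPotential n Ω ((c / 3) • 1) u)) ∧
      -- representation in an arbitrary body
      (StrainGradient.IsUniversalO3 Ω u ↔
        ∀ V ⊆ Ω, IsOpen V → (∃ p, StarConvex ℝ p V) →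
          ∃ c : ℝ, StrainGradient.HasPotential n V ((c / 3) • 1) u) ∧
      -- conversely, all fields of this form are universal
      (∀ F : Matrix (Fin 3) (Fin 3) ℝ, StrainGradient.HasPotential 3 Ω F u →
        StrainGradient.IsUniversalO3 Ω u) ∧
      -- the higher-order terms vanish identically
      (StrainGradient.IsUniversalO3 Ω u →
        (∀ x ∈ Ω, Laplacian.laplacian (Laplacian.laplacian u) x = 0) ∧
        (∀ x ∈ Ω, Laplacian.laplacian (gradient (StrainGradient.divergence u)) x = 0) ∧
        ∀ L : StrainGradient.Material, L.IsClassO3 → ∀ x ∈ Ω, ∀ k,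
          ∑ i, ∑ j, StrainGradient.pd i (StrainGradient.pd j (L.hyperstress u i k j)) x = 0 ∧
          ∑ i, ∑ j, StrainGradient.pd i (StrainGradient.pd j (L.hyperstress u i j k)) x = 0) := by
  refine ⟨StrainGradient.Material.isClassO3_iff, fun n hn Ω hΩ u hu => ?_⟩
  have hu4 : ContDiffOn ℝ 4 u Ω := hu.of_le (WithTop.coe_le_coe.mpr hn)
  have hn3 : (3 : ℕ∞) ≤ n := le_trans (by norm_num) hn
  have hiff := StrainGradient.isUniversalO3_iff hΩ hu4
  have hpot : ∀ V ⊆ Ω, IsOpen V → ∀ F, StrainGradient.HasPotential 3 V F u →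
      StrainGradient.IsClassicalUniversal V u := fun V hVΩ hV F h =>
    h.isClassicalUniversal hV ((hu4.mono hVΩ).of_le (by norm_num))
  refine ⟨hiff.trans (StrainGradient.isClassicalUniversal_iff hΩ hu4), ?_, ?_, ?_, ?_⟩
  · rintro ⟨p, hp⟩
    rw [hiff]
    exact ⟨fun h => h.exists_hasPotential hΩ hp hn hu,
      fun ⟨c, h⟩ => hpot Ω subset_rfl hΩ _ (h.of_le hn3)⟩
  · rw [hiff]
    constructor
    · rintro h V hVΩ hV ⟨p, hp⟩
      exact (h.mono hVΩ).exists_hasPotential hV hp hn (hu.mono hVΩ)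
    · intro h x hx
      -- The conditions are pointwise, so a ball around each point is a sufficient star-shaped test
      -- set, and c may vary from ball to ball.
      obtain ⟨δ, hδ, hball⟩ := Metric.isOpen_iff.mp hΩ x hx
      obtain ⟨c, hc⟩ := h (Metric.ball x δ) hball Metric.isOpen_ball
        ⟨x, (convex_ball x δ).starConvex (Metric.mem_ball_self hδ)⟩
      exact hpot _ hball Metric.isOpen_ball _ (hc.of_le hn3) x (Metric.mem_ball_self hδ)
  · intro F h
    exact hiff.mpr (hpot Ω subset_rfl hΩ F h)
  · intro h
    have hcl := hiff.mp h
    obtain ⟨hlap, hgrad⟩ := (StrainGradient.isClassicalUniversal_iff hΩ hu4).mp hcl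
    exact ⟨fun x hx => StrainGradient.laplacian_eq_zero_of_eqOn_zero hΩ hlap hx,
      fun x hx => StrainGradient.laplacian_eq_zero_of_eqOn_zero hΩ hgrad hx,
      fun L hL x hx k => hcl.sum_pd_pd_hyperstress hL hΩ hu4 hx k⟩
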